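/- **Setting.** Let $\mathcal F=\bigoplus_{n\ge0}\mathrm{Sym}_n L^2(\mathbb R^3\times\{+,-\})^{\otimes n}$ be the photon Fock space, $H_f$, $P_f$ the field energy and momentum (multiplication of $\psi_n$ by $\sum_j|k_j|$, $\sum_jk_j$), and $\mathcal H_{red}=\mathbf 1[H_f<1]\mathcal F$. Let $\sigma\ge0$ and let $\kappa_\sigma\ge0$ be a cutoff, smooth on $(0,\infty)$, supported in $[0,1]$, with $\kappa_\sigma(x)/x^\sigma\to1$ as $x\to0$ and $\sup_x|x^{-\sigma}\kappa_\sigma|+\sup_x|\partial_x(x^{-\sigma}\kappa_\sigma)|<10$. Let $\epsilon(k,\pm)$ be measurable polarization vectors such that $(\epsilon(k,+),\epsilon(k,-),k/|k|)$ is orthonormal for $k\neq 0$, and let $A=a(f)+a^*(f)$ with $f(k,\lambda)=|k|^{-1/2}\kappa_\sigma(|k|)\epsilon(k,\lambda)$. For $p\in\mathbb R^3$, $g\in\mathbb R$ let $$H(p,\sigma)=H_f+\tfrac12(p-P_f-gA)^2,\qquad E(p,\sigma)=\inf\mathrm{spec}\,H(p,\sigma),\qquad H_{(-1)}=H(p,\sigma)-E(p,\sigma).$$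 Let $\chi_r[x]=\sin(\frac\pi2\Theta(x/r))$ and $\bar\chi_r=\sqrt{1-\chi_r^2}$, where $\Theta$ is smooth on $[0,\infty)$ with values in $[0,1]$, $\Theta=1$ on $[0,\frac34]$ and $\Theta=0$ on $[b,\infty)$ for some $b<1$. Let $0<\rho\le\frac12$, and let $\Gamma_\rho$ be the unitary dilatation $(\Gamma_\rho\psi)_n(k_1,\lambda_1,\dots,k_n,\lambda_n)=\rho^{3n/2}\psi_n(\rho k_1,\lambda_1,\dots,\rho k_n,\lambda_n)$. **Feshbach map.** For operators $H,\tau$ on a Hilbert space $\mathcal H$ and commuting cutoff operators $\chi,\bar\chi$ with $0\le\chi\le1$, $\bar\chi=\sqrt{1-\chi^2}$, put $\omega=H-\tau$. Call $(H,\tau)$ a Feshbach pair for $\chi$ if $H,\tau$ are closed, $\chi\mathcal H\subseteq\mathrm{Dom}\,H\subseteq\mathrm{Dom}\,\tau$, $\bar\chi$ leaves $\mathrm{Dom}\,H$ invariant, $\chi,\bar\chi$ commute with $\tau$, and $\tau$ and $\tau+\bar\chi\omega\bar\chi$ are bounded invertible on $\overline{\mathrm{Ran}}\,\bar\chi$.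 Let $\bar R=(\tau+\bar\chi\omega\bar\chi)^{-1}$ on $\overline{\mathrm{Ran}}\,\bar\chi$, and $$F_\chi(H,\tau)=\tau+\chi\omega\chi-\chi\omega\bar\chi\bar R\bar\chi\omega\chi,\quad Q_\chi(H,\tau)=\chi-\bar\chi\bar R\bar\chi\omega\chi,\quad Q_\chi^\sharp(H,\tau)=\chi-\chi\omega\bar\chi\bar R\bar\chi .$$ Define operators on $\mathcal H_{red}$ by $H_{(0)}=F_{\chi_1[H_f]}(H_{(-1)},H_f)\big|_{\mathcal H_{red}}$ and $H_{(k+1)}=\rho^{-1}\Gamma_\rho F_{\chi_\rho[H_f]}(H_{(k)},H_f)\Gamma_\rho^*$. Let $Q^{(\sharp)}_{(-1)}=Q^{(\sharp)}_{\chi_1[H_f]}(H_{(-1)},H_f)$ (with $Q_{(-1)}:\mathcal H_{red}\to\mathcal F$, $Q_{(-1)}^\sharp:\mathcal F\to\mathcal H_{red}$) and $Q^{(\sharp)}_{(k)}=Q^{(\sharp)}_{\chi_\rho[H_f]}(H_{(k)},H_f)$ for $k\ge0$, and $$Q_{(-1,n)}=Q_{(-1)}Q_{(0)}\Gamma_\rho^*Q_{(1)}\Gamma_\rho^*\cdots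 Q_{(n-1)}\Gamma_\rho^*,\qquad Q^\sharp_{(-1,n)}=\Gamma_\rho Q^\sharp_{(n-1)}\cdots\Gamma_\rho Q^\sharp_{(1)}\Gamma_\rho Q^\sharp_{(0)}Q^\sharp_{(-1)}$$ (so $Q^{(\sharp)}_{(-1,0)}=Q^{(\sharp)}_{(-1)}$). **Lemma 14.2.** Let $n\ge0$, and suppose that these objects are defined up to scale $n$, i.e. that $(H_{(-1)},H_f)$ is a Feshbach pair on $\mathcal F$ for $\chi_1[H_f]$ and, for $0\le k<n$, $(H_{(k)},H_f)$ is a Feshbach pair on $\mathcal H_{red}$ for $\chi_\rho[H_f]$. Then $$H_{(-1)}Q_{(-1,n)}=\rho^n(\Gamma_\rho^*)^n\chi_1[H_f]H_{(n)}\quad\text{on }\mathcal H_{red},$$ $$Q^\sharp_{(-1,n)}H_{(-1)}=\rho^nH_{(n)}\chi_1[H_f](\Gamma_\rho)^n\quad\text{on }\mathrm{Dom}\,H_{(-1)},$$ $$Q^\sharp_{(-1,n)}H_{(-1)}Q_{(-1,n)}=\rho^n\Big[H_{(n)}-H_{(n)}\bar\chi_1[H_f]H_f^{-1}\bar\chi_1[H_f]H_{(n)}\Big]\quad\text{on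 }\mathcal H_{red},$$ where $H_f^{-1}$ is taken on $\overline{\mathrm{Ran}}\,\bar\chi_1[H_f]$. Both sides of the first and third identities are defined on all of $\mathcal H_{red}$; in the second, the left side has domain exactly $\mathrm{Dom}\,H_{(-1)}$ and the right side is defined on all of $\mathcal F$. -/

import Mathlib

open MeasureTheory Filter Topology
open scoped ContDiff

noncomputable section

namespace QED

/-! ### Partially defined operators -/

section Operators

variable {E F G : Type*} [AddCommGroup E] [Module ℂ E] [AddCommGroup F] [Module ℂ F]
  [AddCommGroup G] [Module ℂ G]

/-- The composition `S T` of partially defined operators, on its maximal domain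
`{x ∈ Dom T | T x ∈ Dom S}`. -/
def pcomp (S : F →ₗ.[ℂ] G) (T : E →ₗ.[ℂ] F) : E →ₗ.[ℂ] G :=
  S.comp (T.domRestrict ((S.domain.comap T.toFun).map T.domain.subtype)) (by
    rintro ⟨x, hx⟩
    obtain ⟨⟨y, hy, hyx⟩, hxT⟩ := Submodule.mem_inf.1 hx
    have : (T.domRestrict ((S.domain.comap T.toFun).map T.domain.subtype)) ⟨x, hx⟩ = T y :=
      LinearPMap.domRestrict_apply (by simpa using hyx.symm)
    rw [this]
    exact hy)

infixr:80 " ∘ₚ " => pcomp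

/-- The identity operator, everywhere defined. -/
def pid (E : Type*) [AddCommGroup E] [Module ℂ E] : E →ₗ.[ℂ] E :=
  (LinearMap.id : E →ₗ[ℂ] E).toPMap ⊤

/-- Powers of a partially defined operator. -/
def ppow (T : E →ₗ.[ℂ] E) : ℕ → (E →ₗ.[ℂ] E)
  | 0 => pid E
  | n + 1 => T ∘ₚ ppow T n

end Operators

section Feshbach

variable {𝓗 : Type*} [NormedAddCommGroup 𝓗] [InnerProductSpace ℂ 𝓗]

/-- `T` is bounded invertible on the subspace `K`: it maps `Dom T ∩ K` bijectively onto `K`, with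
bounded inverse (injectivity is contained in the last condition). -/
structure BoundedInvertibleOn (T : 𝓗 →ₗ.[ℂ] 𝓗) (K : Submodule ℂ 𝓗) : Prop where
  maps_to : ∀ x : T.domain, (x : 𝓗) ∈ K → T x ∈ K
  surj : ∀ y ∈ K, ∃ x : T.domain, (x : 𝓗) ∈ K ∧ T x = y
  bounded : ∃ C : ℝ, ∀ x : T.domain, (x : 𝓗) ∈ K → ‖(x : 𝓗)‖ ≤ C * ‖T x‖

/-- The spectrum of a partially defined operator. -/
def pspectrum (T : 𝓗 →ₗ.[ℂ] 𝓗) : Set ℂ :=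
  {z | ¬ BoundedInvertibleOn (T - z • pid 𝓗) ⊤}

/-- The infimum of the (real) spectrum. -/
def specInf (T : 𝓗 →ₗ.[ℂ] 𝓗) : ℝ := sInf {x : ℝ | (x : ℂ) ∈ pspectrum T}

/-- The closed subspace `Ran χ` (the range of the projection `P_χ`). -/
def ran (χ : 𝓗 →ₗ.[ℂ] 𝓗) : Submodule ℂ 𝓗 := (LinearMap.range χ.toFun).topologicalClosure

/-- The inverse on `K` of the restriction of `T` to `K`. -/
def invOn (T : 𝓗 →ₗ.[ℂ] 𝓗) (K : Submodule ℂ 𝓗) : 𝓗 →ₗ.[ℂ] 𝓗 := (T.domRestrict K).inverse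

/-- `H_χ̄ = τ + χ̄ ω χ̄`, where `ω = H - τ`. -/
def Hbar (H τ χb : 𝓗 →ₗ.[ℂ] 𝓗) : 𝓗 →ₗ.[ℂ] 𝓗 := τ + χb ∘ₚ (H - τ) ∘ₚ χb

/-- `R̄ = H_χ̄⁻¹` on `Ran χ̄`. -/
def Rbar (H τ χb : 𝓗 →ₗ.[ℂ] 𝓗) : 𝓗 →ₗ.[ℂ] 𝓗 := invOn (Hbar H τ χb) (ran χb)

/-- `(H, τ)` is a Feshbach pair corresponding to the cutoff operators `χ`, `χ̄`.
`Dom H` is only required to be contained in `Dom τ` (so that `ω = H - τ` is defined on `Dom H`) and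
to contain `χ 𝓗` (which in particular makes `Dom H` invariant under `χ`). -/
structure FeshbachPair (H τ χ χb : 𝓗 →ₗ.[ℂ] 𝓗) : Prop where
  closed_H : H.IsClosed
  closed_τ : τ.IsClosed
  domain_le : H.domain ≤ τ.domain
  /-- `χ 𝓗 ⊆ Dom H` -/
  domain_χ : (H ∘ₚ χ).domain = ⊤
  /-- `χ̄ (Dom H) ⊆ Dom H` -/
  domain_χb : H.domain ≤ (H ∘ₚ χb).domain
  comm_χ : χ ∘ₚ τ ≤ τ ∘ₚ χ
  comm_χb : χb ∘ₚ τ ≤ τ ∘ₚ χb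
  inv_τ : BoundedInvertibleOn τ (ran χb)
  inv_Hbar : BoundedInvertibleOn (Hbar H τ χb) (ran χb)

/-- The smooth Feshbach map `F_χ(H, τ) = τ + χ ω χ - χ ω χ̄ R̄ χ̄ ω χ`. -/
def feshbach (H τ χ χb : 𝓗 →ₗ.[ℂ] 𝓗) : 𝓗 →ₗ.[ℂ] 𝓗 :=
  τ + χ ∘ₚ (H - τ) ∘ₚ χ - χ ∘ₚ (H - τ) ∘ₚ χb ∘ₚ Rbar H τ χb ∘ₚ χb ∘ₚ (H - τ) ∘ₚ χ

/-- `Q_χ(H, τ) = χ - χ̄ R̄ χ̄ ω χ`. -/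
def feshQ (H τ χ χb : 𝓗 →ₗ.[ℂ] 𝓗) : 𝓗 →ₗ.[ℂ] 𝓗 :=
  χ - χb ∘ₚ Rbar H τ χb ∘ₚ χb ∘ₚ (H - τ) ∘ₚ χ

/-- `Q_χ^♯(H, τ) = χ - χ ω χ̄ R̄ χ̄`. -/
def feshQs (H τ χ χb : 𝓗 →ₗ.[ℂ] 𝓗) : 𝓗 →ₗ.[ℂ] 𝓗 :=
  χ - χ ∘ₚ (H - τ) ∘ₚ χb ∘ₚ Rbar H τ χb ∘ₚ χb

end Feshbach

/-! ### Photon Fock space -/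

/-- Photon momenta `k ∈ ℝ³`. -/
abbrev Mom : Type := EuclideanSpace ℝ (Fin 3)

/-- `K = (k, λ)`: momentum and polarization label (`true` is `+`, `false` is `-`). -/
abbrev Photon : Type := Mom × Bool

/-- `∫ dK = ∑_λ ∫ d³k`. -/
def photonMeasure : Measure Photon := (volume : Measure Mom).prod Measure.count

instance : SigmaFinite photonMeasure := by
  unfold photonMeasure; infer_instance

/-- Configurations `(K_1, …, K_n)`. -/
abbrev Conf (n : ℕ) : Type := Fin n → Photon

/-- `dK_1 ⋯ dK_n`. -/
def confMeasure (n : ℕ) : Measure (Conf n) := Measure.pi fun _ => photonMeasure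

/-- Sequences `(ψ_0, ψ_1, …)` of square integrable `n`-photon functions with
`∑_n ‖ψ_n‖² < ∞`, not necessarily symmetric. -/
abbrev FullFock : Type := lp (fun n : ℕ => Lp ℂ 2 (confMeasure n)) 2

/-- Scaling of a configuration, `(K_1, …, K_n) ↦ (r K_1, …, r K_n)` with `r (k, λ) = (r k, λ)`. -/
def scale (r : ℝ) {n : ℕ} (K : Conf n) : Conf n := fun j => (r • (K j).1, (K j).2)

lemma quasi_perm {n : ℕ} (π : Equiv.Perm (Fin n)) :
    Measure.QuasiMeasurePreserving (fun K : Conf n => K ∘ π) (confMeasure n) (confMeasure n) := by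
  have h := measurePreserving_piCongrLeft (fun _ : Fin n => photonMeasure) π.symm
  have h2 : (MeasurableEquiv.piCongrLeft (fun _ : Fin n => Photon) π.symm : Conf n → Conf n)
      = fun K => K ∘ π := by
    funext K
    funext j
    have := Equiv.piCongrLeft_apply_apply (fun _ : Fin n => Photon) π.symm K (π j)
    rw [Equiv.symm_apply_apply] at this
    exact this
  rw [h2] at h
  exact h.quasiMeasurePreserving

lemma quasi_scale {r : ℝ} (hr : r ≠ 0) (n : ℕ) :
    Measure.QuasiMeasurePreserving (scale r : Conf n → Conf n)
      (confMeasure n) (confMeasure n) := by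
  set c : NNReal := Real.toNNReal |(r ^ Module.finrank ℝ Mom)⁻¹| with hc
  have hmf : Measurable (fun K : Photon => ((r • K.1, K.2) : Photon)) := by fun_prop
  have h1 : photonMeasure.map (fun K : Photon => ((r • K.1, K.2) : Photon))
      = c • photonMeasure := by
    have h := Measure.map_prod_map (volume : Measure Mom) (Measure.count : Measure Bool)
      (f := fun k : Mom => r • k) (g := id) (by fun_prop) measurable_id
    rw [Measure.map_addHaar_smul _ hr, Measure.map_id, Measure.prod_smul_left] at h
    exact h.symm
  clear_value c
  have hfs : ∀ _ : Fin n, SigmaFinite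
      (photonMeasure.map (fun K : Photon => ((r • K.1, K.2) : Photon))) := by
    intro _; rw [h1]; infer_instance
  have h2 := Measure.pi_map_pi (μ := fun _ : Fin n => photonMeasure) (hμ := hfs)
    (f := fun _ K => ((r • K.1, K.2) : Photon)) (fun _ => hmf.aemeasurable)
  refine ⟨?_, ?_⟩
  · unfold scale; fun_prop
  · have h3 : (confMeasure n).map (scale r) = c ^ n • confMeasure n := by
      simp only [h1] at h2
      refine Eq.trans h2 (Measure.pi_eq fun s hs => ?_)
      simp only [confMeasure, Measure.smul_apply, Measure.pi_pi, ENNReal.smul_def, smul_eq_mul,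
        Finset.prod_mul_distrib, Finset.prod_const, Finset.card_univ, Fintype.card_fin,
        ENNReal.coe_pow]
    rw [h3]
    exact Measure.smul_absolutelyContinuous

lemma ae_cons {n : ℕ} {P : Conf (n + 1) → Prop} (h : ∀ᵐ K ∂confMeasure (n + 1), P K) :
    ∀ᵐ K ∂confMeasure n, ∀ᵐ q ∂photonMeasure, P (Fin.cons q K) := by
  have e := (measurePreserving_piFinSuccAbove (fun _ : Fin (n + 1) => photonMeasure) 0).symm
  have h1 := e.quasiMeasurePreserving.ae h
  have h2 := Measure.ae_ae_of_ae_prod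
    (Measure.measurePreserving_swap.quasiMeasurePreserving.ae h1)
  filter_upwards [h2] with K hK
  filter_upwards [hK] with q hq
  simpa [MeasurableEquiv.piFinSuccAbove, Fin.insertNthEquiv] using hq

lemma coe_add_ae (ψ φ : FullFock) (n : ℕ) :
    ((ψ + φ) n : Conf n → ℂ) =ᵐ[confMeasure n] fun K => ψ n K + φ n K := by
  rw [lp.coeFn_add, Pi.add_apply]
  exact Lp.coeFn_add _ _

lemma coe_smul_ae (c : ℂ) (ψ : FullFock) (n : ℕ) :
    ((c • ψ) n : Conf n → ℂ) =ᵐ[confMeasure n] fun K => c * ψ n K := by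
  rw [lp.coeFn_smul, Pi.smul_apply]
  exact Lp.coeFn_smul _ _

lemma coe_zero_ae (n : ℕ) :
    ((0 : FullFock) n : Conf n → ℂ) =ᵐ[confMeasure n] fun _ => 0 := by
  rw [lp.coeFn_zero, Pi.zero_apply]
  exact Lp.coeFn_zero _ _ _

/-- The bosonic Fock space: all `ψ_n` are symmetric under permutations of `K_1, …, K_n`. -/
def Fock : Submodule ℂ FullFock where
  carrier := {ψ | ∀ (n : ℕ) (π : Equiv.Perm (Fin n)),
    ∀ᵐ K ∂confMeasure n, ψ n (K ∘ π) = ψ n K}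
  add_mem' := by
    intro ψ φ hψ hφ n π
    filter_upwards [hψ n π, hφ n π, coe_add_ae ψ φ n, (quasi_perm π).ae (coe_add_ae ψ φ n)]
      with K h1 h2 h3 h4
    rw [h3, h4, h1, h2]
  zero_mem' := by
    intro n π
    filter_upwards [coe_zero_ae n, (quasi_perm π).ae (coe_zero_ae n)] with K h3 h4
    rw [h3, h4]
  smul_mem' := by
    intro c ψ hψ n π
    filter_upwards [hψ n π, coe_smul_ae c ψ n, (quasi_perm π).ae (coe_smul_ae c ψ n)]
      with K h1 h3 h4
    rw [h3, h4, h1]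

/-- The field energy `|k_1| + ⋯ + |k_n|`. -/
def energy {n : ℕ} (K : Conf n) : ℝ := ∑ j, ‖(K j).1‖

/-- `𝓗_red = 1[H_f < 1] 𝓕`. -/
def Hred : Submodule ℂ FullFock where
  carrier := {ψ | ψ ∈ Fock ∧ ∀ n, ∀ᵐ K ∂confMeasure n, 1 ≤ energy K → ψ n K = 0}
  add_mem' := by
    rintro ψ φ ⟨hψ, hψ'⟩ ⟨hφ, hφ'⟩
    refine ⟨Fock.add_mem hψ hφ, fun n => ?_⟩
    filter_upwards [hψ' n, hφ' n, coe_add_ae ψ φ n] with K h1 h2 h3 h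
    rw [h3, h1 h, h2 h, add_zero]
  zero_mem' := by
    refine ⟨Fock.zero_mem, fun n => ?_⟩
    filter_upwards [coe_zero_ae n] with K h3 _
    rw [h3]
  smul_mem' := by
    rintro c ψ ⟨hψ, hψ'⟩
    refine ⟨Fock.smul_mem c hψ, fun n => ?_⟩
    filter_upwards [hψ' n, coe_smul_ae c ψ n] with K h1 h3 h
    rw [h3, h1 h, mul_zero]

/-- The graph of `mulOp`. -/
def mulGraph (V W : Submodule ℂ FullFock) (m : ∀ n, Conf n → ℂ) : Submodule ℂ (V × W) where
  carrier := {x | ∀ n, ∀ᵐ K ∂confMeasure n, (x.2 : FullFock) n K = m n K * (x.1 : FullFock) n K}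
  add_mem' := by
    intro x y hx hy n
    filter_upwards [hx n, hy n, coe_add_ae x.1 y.1 n, coe_add_ae x.2 y.2 n] with K h1 h2 h3 h4
    simp only [Prod.fst_add, Prod.snd_add, Submodule.coe_add]
    rw [h3, h4, h1, h2]; ring
  zero_mem' := by
    intro n
    filter_upwards [coe_zero_ae n] with K h
    simp only [Prod.fst_zero, Prod.snd_zero, Submodule.coe_zero]
    rw [h]; ring
  smul_mem' := by
    intro c x hx n
    filter_upwards [hx n, coe_smul_ae c x.1 n, coe_smul_ae c x.2 n] with K h1 h3 h4
    simp only [Prod.smul_fst, Prod.smul_snd, Submodule.coe_smul]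
    rw [h3, h4, h1]; ring

/-- The operator from `V` to `W` of multiplication by the functions `m_n(K_1, …, K_n)`, on its
maximal domain `{ψ ∈ V | m ψ ∈ W}`. -/
def mulOp (V W : Submodule ℂ FullFock) (m : ∀ n, Conf n → ℂ) : V →ₗ.[ℂ] W :=
  (mulGraph V W m).toLinearPMap

/-- The operator `f(H_f)`, as an operator from `V` to `W` (with maximal domain). -/
def fnHf (V W : Submodule ℂ FullFock) (f : ℝ → ℝ) : V →ₗ.[ℂ] W :=
  mulOp V W fun _ K => (f (energy K) : ℂ)

/-- The field Hamiltonian `H_f` on `V`. -/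
def Hf (V : Submodule ℂ FullFock) : V →ₗ.[ℂ] V := fnHf V V fun x => x

/-- The identification of vectors of `V ∩ W`, as an operator from `V` to `W`: the inclusion if
`V ⊆ W`, and defined on `W` if `W ⊆ V`. -/
def ident (V W : Submodule ℂ FullFock) : V →ₗ.[ℂ] W := fnHf V W fun _ => 1

/-- The `i`-th component of the field momentum `P_f`. -/
def Pf (i : Fin 3) : Fock →ₗ.[ℂ] Fock :=
  mulOp Fock Fock fun _ K => ((∑ j, (K j).1 i : ℝ) : ℂ)

/-- The graph of `dil`. -/
def dilGraph (V W : Submodule ℂ FullFock) (r : ℝ) (hr : 0 < r) : Submodule ℂ (V × W) where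
  carrier := {x | ∀ n : ℕ, ∀ᵐ K ∂confMeasure n,
    (x.2 : FullFock) n K = ((r ^ (3 * (n : ℝ) / 2) : ℝ) : ℂ) * (x.1 : FullFock) n (scale r K)}
  add_mem' := by
    intro x y hx hy n
    filter_upwards [hx n, hy n, (quasi_scale hr.ne' n).ae (coe_add_ae x.1 y.1 n),
      coe_add_ae x.2 y.2 n] with K h1 h2 h3 h4
    simp only [Prod.fst_add, Prod.snd_add, Submodule.coe_add]
    rw [h3, h4, h1, h2]; ring
  zero_mem' := by
    intro n
    filter_upwards [coe_zero_ae n, (quasi_scale hr.ne' n).ae (coe_zero_ae n)] with K h h'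
    simp only [Prod.fst_zero, Prod.snd_zero, Submodule.coe_zero]
    rw [h, h']; ring
  smul_mem' := by
    intro c x hx n
    filter_upwards [hx n, (quasi_scale hr.ne' n).ae (coe_smul_ae c x.1 n),
      coe_smul_ae c x.2 n] with K h1 h3 h4
    simp only [Prod.smul_fst, Prod.smul_snd, Submodule.coe_smul]
    rw [h3, h4, h1]; ring

/-- The dilatation `(Γ_r ψ)_n(K_1, …, K_n) = r^{3n/2} ψ_n(r K_1, …, r K_n)`, as an operator from `V`
to `W` with maximal domain `{ψ ∈ V | Γ_r ψ ∈ W}`. It is unitary on the Fock space, fixes the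
vacuum, satisfies `Γ_r a^♯(K) Γ_r^* = r^{-3/2} a^♯(r⁻¹ K)`, and `Γ_r^* = Γ_{1/r}`. -/
def dil (V W : Submodule ℂ FullFock) (r : ℝ) (hr : 0 < r) : V →ₗ.[ℂ] W :=
  (dilGraph V W r hr).toLinearPMap

/-- The graph of `annih`. -/
def annihGraph (f : Photon → ℂ) : Submodule ℂ (Fock × Fock) where
  carrier := {x | ∀ n : ℕ, ∀ᵐ K ∂confMeasure n,
    Integrable (fun q => star (f q) * (x.1 : FullFock) (n + 1) (Fin.cons q K)) photonMeasure ∧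
    (x.2 : FullFock) n K = (Real.sqrt (n + 1) : ℂ) *
      ∫ q, star (f q) * (x.1 : FullFock) (n + 1) (Fin.cons q K) ∂photonMeasure}
  add_mem' := by
    intro x y hx hy n
    filter_upwards [hx n, hy n, ae_cons (coe_add_ae x.1 y.1 (n + 1)),
      coe_add_ae x.2 y.2 n] with K h1 h2 h3 h4
    have h5 : (fun q => star (f q) * ((x + y).1 : FullFock) (n + 1) (Fin.cons q K))
        =ᵐ[photonMeasure] fun q => star (f q) * (x.1 : FullFock) (n + 1) (Fin.cons q K) +
          star (f q) * (y.1 : FullFock) (n + 1) (Fin.cons q K) := by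
      filter_upwards [h3] with q hq
      simp only [Prod.fst_add, Submodule.coe_add]
      rw [hq]; ring
    refine ⟨(h1.1.add h2.1).congr h5.symm, ?_⟩
    rw [integral_congr_ae h5, integral_add h1.1 h2.1]
    simp only [Prod.snd_add, Submodule.coe_add]
    rw [h4, h1.2, h2.2]; ring
  zero_mem' := by
    intro n
    filter_upwards [ae_cons (coe_zero_ae (n + 1)), coe_zero_ae n] with K h3 h4
    have h5 : (fun q => star (f q) * ((0 : Fock × Fock).1 : FullFock) (n + 1) (Fin.cons q K))
        =ᵐ[photonMeasure] fun _ => 0 := by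
      filter_upwards [h3] with q hq
      simp only [Prod.fst_zero, Submodule.coe_zero]
      rw [hq]; ring
    refine ⟨(integrable_zero _ _ _).congr h5.symm, ?_⟩
    rw [integral_congr_ae h5]
    simp only [Prod.snd_zero, Submodule.coe_zero]
    rw [h4]; simp
  smul_mem' := by
    intro c x hx n
    filter_upwards [hx n, ae_cons (coe_smul_ae c x.1 (n + 1)), coe_smul_ae c x.2 n]
      with K h1 h3 h4
    have h5 : (fun q => star (f q) * ((c • x).1 : FullFock) (n + 1) (Fin.cons q K))
        =ᵐ[photonMeasure]
          fun q => c * (star (f q) * (x.1 : FullFock) (n + 1) (Fin.cons q K)) := by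
      filter_upwards [h3] with q hq
      simp only [Prod.smul_fst, Submodule.coe_smul]
      rw [hq]; ring
    refine ⟨(h1.1.const_mul c).congr h5.symm, ?_⟩
    rw [integral_congr_ae h5, integral_const_mul]
    simp only [Prod.smul_snd, Submodule.coe_smul]
    rw [h4, h1.2]; ring

/-- The (closed) annihilation operator `a(f) = ∫ dK conj(f(K)) a(K)`,
`(a(f) ψ)_n(K_1, …, K_n) = √(n+1) ∫ dK conj(f(K)) ψ_{n+1}(K, K_1, …, K_n)`. The integrability
condition holds automatically for square integrable `f`. -/
def annih (f : Photon → ℂ) : Fock →ₗ.[ℂ] Fock := (annihGraph f).toLinearPMap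

/-- The creation operator `a^*(f)`, the adjoint of `a(f)`: `φ = a^*(f) ψ` iff
`⟨a(f) η, ψ⟩ = ⟨η, φ⟩` for all `η ∈ Dom a(f)`. -/
def creat (f : Photon → ℂ) : Fock →ₗ.[ℂ] Fock :=
  Submodule.toLinearPMap (R := ℂ) (E := Fock) (F := Fock)
    { carrier := {x | ∀ η : (annih f).domain, inner ℂ (annih f η) x.1 = inner ℂ (η : Fock) x.2}
      add_mem' := by
        intro x y hx hy η
        simp only [Prod.fst_add, Prod.snd_add, inner_add_right]
        rw [hx η, hy η]
      zero_mem' := by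
        intro η
        simp
      smul_mem' := by
        intro c x hx η
        simp only [Prod.smul_fst, Prod.smul_snd, inner_smul_right]
        rw [hx η] }

/-! ### The model -/

/-- `κ` is an admissible cutoff function for the infrared parameter `σ`: smooth, nonnegative,
supported in `[0, 1]`, with `‖κ‖_σ + ‖x^σ ∂_x (x^{-σ} κ)‖_σ < 10`, where
`‖f‖_σ = sup_x |x^{-σ} f(x)|`, and `κ(x) / x^σ → 1` as `x → 0`. -/
structure IsCutoff (σ : ℝ) (κ : ℝ → ℝ) : Prop where
  smooth : ContDiffOn ℝ ∞ κ (Set.Ioi 0)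
  nonneg : ∀ x, 0 ≤ x → 0 ≤ κ x
  support : ∀ x, 1 < x → κ x = 0
  bound : ∃ a b : ℝ, a + b < 10 ∧ (∀ x, 0 < x → |x ^ (-σ) * κ x| ≤ a) ∧
    ∀ x, 0 < x → |deriv (fun y => y ^ (-σ) * κ y) x| ≤ b
  limit : Tendsto (fun x => κ x / x ^ σ) (𝓝[>] 0) (𝓝 1)

/-- The data of the model and of the renormalization group: total momentum `p`, infrared parameter
`σ`, charge `g`, form factor `κ_σ`, polarization vectors `ε(k, λ)`, the function `Θ` defining the
smooth energy cutoffs, and the scale factor `ρ`. -/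
structure Model where
  p : Mom
  σ : ℝ
  σ_nonneg : 0 ≤ σ
  g : ℝ
  κ : ℝ → ℝ
  κ_cutoff : IsCutoff σ κ
  ε : Mom → Bool → Mom
  ε_measurable : ∀ l, Measurable fun k => ε k l
  ε_norm : ∀ k l, k ≠ 0 → ‖ε k l‖ = 1
  ε_orth : ∀ k, k ≠ 0 → inner ℝ (ε k true) (ε k false) = 0
  ε_transverse : ∀ k l, k ≠ 0 → inner ℝ (ε k l) k = 0
  Θ : ℝ → ℝ
  Θ_smooth : ContDiffOn ℝ ∞ Θ (Set.Ici 0)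
  Θ_mem : ∀ x, 0 ≤ x → Θ x ∈ Set.Icc (0 : ℝ) 1
  Θ_one : ∀ x, 0 ≤ x → x ≤ 3 / 4 → Θ x = 1
  Θ_support : ∃ b < 1, ∀ x, b ≤ x → Θ x = 0
  ρ : ℝ
  ρ_pos : 0 < ρ
  ρ_le : ρ ≤ 1 / 2

namespace Model

variable (M : Model)

/-- The `i`-th component of the vector potential `A_{κ_σ}(0) = a(f_i) + a^*(f_i)`, where
`f_i(k, λ) = |k|^{-1/2} κ_σ(|k|) ε_i(k, λ)`. -/
def A (i : Fin 3) : Fock →ₗ.[ℂ] Fock :=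
  let f : Photon → ℂ := fun K => ((M.κ ‖K.1‖ / Real.sqrt ‖K.1‖ * M.ε K.1 K.2 i : ℝ) : ℂ)
  annih f + creat f

/-- The `i`-th component of `p - P_f - g A`. -/
def velocity (i : Fin 3) : Fock →ₗ.[ℂ] Fock :=
  ((M.p i : ℝ) : ℂ) • pid Fock - Pf i - (M.g : ℂ) • M.A i

/-- The fiber Hamiltonian `H(p, σ) = H_f + (p - P_f - g A)² / 2`. -/
def fiberH : Fock →ₗ.[ℂ] Fock :=
  Hf Fock + (1 / 2 : ℂ) • ∑ i : Fin 3, M.velocity i ∘ₚ M.velocity i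

/-- `E(p, σ) = inf spec H(p, σ)`. -/
def groundE : ℝ := specInf M.fiberH

/-- `H_(-1) = H(p, σ) - E(p, σ)`, on the Fock space. -/
def Hm1 : Fock →ₗ.[ℂ] Fock := M.fiberH - (M.groundE : ℂ) • pid Fock

/-- The function `χ_r(x) = sin(π/2 Θ(x/r))`. -/
def chi (r x : ℝ) : ℝ := Real.sin (Real.pi / 2 * M.Θ (x / r))

/-- The function `χ̄_r = √(1 - χ_r²)`. -/
def chib (r x : ℝ) : ℝ := Real.sqrt (1 - M.chi r x ^ 2)

/-- `(H_(-1), H_f)` is a Feshbach pair on `𝓕` corresponding to `χ_1[H_f]`. -/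
def InitialFeshbachPair : Prop :=
  FeshbachPair M.Hm1 (Hf Fock) (fnHf Fock Fock (M.chi 1)) (fnHf Fock Fock (M.chib 1))

/-- `(T, H_f)` is a Feshbach pair on `𝓗_red` corresponding to `χ_ρ[H_f]`. -/
def RedFeshbachPair (T : Hred →ₗ.[ℂ] Hred) : Prop :=
  FeshbachPair T (Hf Hred) (fnHf Hred Hred (M.chi M.ρ)) (fnHf Hred Hred (M.chib M.ρ))

/-- The dilatation `Γ_ρ`, as a partially defined operator from `V` to `W`. -/
def Γ (V W : Submodule ℂ FullFock) : V →ₗ.[ℂ] W := dil V W M.ρ M.ρ_pos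

/-- `Γ_ρ^*`, as a partially defined operator from `V` to `W`. -/
def Γstar (V W : Submodule ℂ FullFock) : V →ₗ.[ℂ] W := dil V W M.ρ⁻¹ (inv_pos.2 M.ρ_pos)

/-- The renormalization map on operators on `𝓗_red`,
`R_ρ^H[T] = S_ρ[F_{χ_ρ[H_f]}(T, H_f)]` with `S_ρ[B] = ρ⁻¹ Γ_ρ B Γ_ρ^*`. -/
def renorm (T : Hred →ₗ.[ℂ] Hred) : Hred →ₗ.[ℂ] Hred :=
  ((M.ρ⁻¹ : ℝ) : ℂ) • (M.Γ Hred Hred ∘ₚ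
    feshbach T (Hf Hred) (fnHf Hred Hred (M.chi M.ρ)) (fnHf Hred Hred (M.chib M.ρ)) ∘ₚ
    M.Γstar Hred Hred)

/-- The effective Hamiltonians on `𝓗_red`: `H_(0) = F_{χ_1[H_f]}(H_(-1), H_f)` restricted to
`𝓗_red`, and `H_(n+1) = R_ρ^H[H_(n)]`. -/
def H : ℕ → (Hred →ₗ.[ℂ] Hred)
  | 0 => ident Fock Hred ∘ₚ
      feshbach M.Hm1 (Hf Fock) (fnHf Fock Fock (M.chi 1)) (fnHf Fock Fock (M.chib 1)) ∘ₚ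
      ident Hred Fock
  | n + 1 => M.renorm (H n)

/-- `Q_(-1) = Q_{χ_1[H_f]}(H_(-1), H_f)`, from `𝓗_red` to `𝓕`. -/
def Qm1 : Hred →ₗ.[ℂ] Fock :=
  feshQ M.Hm1 (Hf Fock) (fnHf Fock Fock (M.chi 1)) (fnHf Fock Fock (M.chib 1)) ∘ₚ
    ident Hred Fock

/-- `Q_(-1)^♯ = Q^♯_{χ_1[H_f]}(H_(-1), H_f)`, from `𝓕` to `𝓗_red`. -/
def Qm1s : Fock →ₗ.[ℂ] Hred :=
  ident Fock Hred ∘ₚ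
    feshQs M.Hm1 (Hf Fock) (fnHf Fock Fock (M.chi 1)) (fnHf Fock Fock (M.chib 1))

/-- `Q_(k) = Q_{χ_ρ[H_f]}(H_(k), H_f)`, `k ≥ 0`. -/
def Q (k : ℕ) : Hred →ₗ.[ℂ] Hred :=
  feshQ (M.H k) (Hf Hred) (fnHf Hred Hred (M.chi M.ρ)) (fnHf Hred Hred (M.chib M.ρ))

/-- `Q_(k)^♯ = Q^♯_{χ_ρ[H_f]}(H_(k), H_f)`, `k ≥ 0`. -/
def Qs (k : ℕ) : Hred →ₗ.[ℂ] Hred :=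
  feshQs (M.H k) (Hf Hred) (fnHf Hred Hred (M.chi M.ρ)) (fnHf Hred Hred (M.chib M.ρ))

/-- `Q_(0,n) = Q_(0) Γ_ρ^* Q_(1) Γ_ρ^* ⋯ Q_(n-1) Γ_ρ^*`, with `Q_(0,0) = 1`. -/
def Q0 : ℕ → (Hred →ₗ.[ℂ] Hred)
  | 0 => pid Hred
  | n + 1 => Q0 n ∘ₚ M.Q n ∘ₚ M.Γstar Hred Hred

/-- `Q_(0,n)^♯ = Γ_ρ Q_(n-1)^♯ ⋯ Γ_ρ Q_(1)^♯ Γ_ρ Q_(0)^♯`, with `Q_(0,0)^♯ = 1`. -/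
def Q0s : ℕ → (Hred →ₗ.[ℂ] Hred)
  | 0 => pid Hred
  | n + 1 => M.Γ Hred Hred ∘ₚ M.Qs n ∘ₚ Q0s n

/-- `Q_(-1,n) = Q_(-1) Q_(0,n)`. -/
def Qm1n (n : ℕ) : Hred →ₗ.[ℂ] Fock := M.Qm1 ∘ₚ M.Q0 n

/-- `Q_(-1,n)^♯ = Q_(0,n)^♯ Q_(-1)^♯`. -/
def Qm1ns (n : ℕ) : Fock →ₗ.[ℂ] Hred := M.Q0s n ∘ₚ M.Qm1s

end Model

end QED

end

open QED

/-!
# Intertwining and collapsing identities for the iterated Feshbach map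

The proof rests on three algebraic identities for one Feshbach map, with `F = F_χ(H, τ)`:
`H Q = χ F` (`FeshbachPair.H_feshQ`), `Q^♯ H = F χ` (`FeshbachPair.feshQs_H`) and
`Q^♯ χ = 1 - F χ̄ τ⁻¹ χ̄` (`FeshbachPair.feshQs_chi`). The first and the last give
`Q^♯ H Q = F - F χ̄ τ⁻¹ χ̄ F`. All of them follow from `χ² + χ̄² = 1`, the commutation of `χ`, `χ̄`
and `τ`, and the defining equation of `R̄`.

The identities at scale `n + 1` follow from those at scale `n` by multiplying with `Q_(n) Γ_ρ^*` on
the right and with `Γ_ρ Q_(n)^♯` on the left. Three facts make the products collapse. Since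
`χ_1 = 1` on the support of `χ_ρ` (this is where `ρ ≤ 1/2` enters), `χ_1 χ_ρ = χ_ρ` and `χ̄_1 χ_ρ = 0`; the
latter removes the correction term of scale `n`, because `H_(n) Q_(n)` has values in the range of
`χ_ρ[H_f]`. Since `Γ_ρ f(H_f) Γ_ρ^* = f(ρ H_f)`, dilatation turns `χ_ρ` into `χ_1` and `H_f⁻¹` into
`ρ⁻¹ H_f⁻¹`. And `F_{χ_ρ}(T, H_f)` preserves the spectral subspace `H_f < ρ`, so that `Γ_ρ` maps
back into `𝓗_red`, and the `H_(n)` are everywhere defined.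

Partially defined operators are handled through their graphs: `Maps T x y` says that `x ∈ Dom T` and
`T x = y`. Equality of everywhere defined operators then reduces to finding, for each `x`, a common
value of both sides (`eq_of_forall_exists_maps`), and every domain question is answered along with
the computation. Functions of `H_f` and dilatations are similarly described by the relations `EMul`
and `Dil` on the ambient space `FullFock`, which avoids tracking the subspaces `Fock` and `Hred`.
-/

namespace QED

/-! ### Partially defined operators as relations -/

section Maps

variable {E F G : Type*} [AddCommGroup E] [Module ℂ E] [AddCommGroup F] [Module ℂ F]
  [AddCommGroup G] [Module ℂ G]

/-- `x ∈ Dom T` and `T x = y`. Written as a relation on the graph, so that domain conditions and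
values are handled together. -/
def Maps (T : E →ₗ.[ℂ] F) (x : E) (y : F) : Prop := (x, y) ∈ T.graph

lemma maps_iff {T : E →ₗ.[ℂ] F} {x : E} {y : F} :
    Maps T x y ↔ ∃ h : x ∈ T.domain, T ⟨x, h⟩ = y := by
  unfold Maps
  rw [LinearPMap.mem_graph_iff]
  constructor
  · rintro ⟨⟨z, hz⟩, h1, h2⟩
    obtain rfl : z = x := h1
    exact ⟨hz, h2⟩
  · rintro ⟨h, h2⟩
    exact ⟨⟨x, h⟩, rfl, h2⟩

lemma mem_domain_iff_maps {T : E →ₗ.[ℂ] F} {x : E} : x ∈ T.domain ↔ ∃ y, Maps T x y :=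
  LinearPMap.mem_domain_iff

lemma maps_apply (T : E →ₗ.[ℂ] F) (x : T.domain) : Maps T x (T x) := T.mem_graph x

namespace Maps

variable {T : E →ₗ.[ℂ] F} {x x' : E} {y y' : F}

lemma mem_domain (h : Maps T x y) : x ∈ T.domain := mem_domain_iff_maps.2 ⟨y, h⟩

lemma unique (h : Maps T x y) (h' : Maps T x y') : y = y' :=
  LinearPMap.mem_graph_snd_inj T h h' rfl

lemma sub (h : Maps T x y) (h' : Maps T x' y') : Maps T (x - x') (y - y') :=
  T.graph.sub_mem h h'

lemma smul (c : ℂ) (h : Maps T x y) : Maps T (c • x) (c • y) :=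
  T.graph.smul_mem c h

lemma zero (T : E →ₗ.[ℂ] F) : Maps T 0 0 := T.graph.zero_mem

lemma congr (h : Maps T x y) (hx : x = x') (hy : y = y') : Maps T x' y' := hx ▸ hy ▸ h

end Maps

lemma maps_comp {S : F →ₗ.[ℂ] G} {T : E →ₗ.[ℂ] F} {x : E} {z : G} :
    Maps (S ∘ₚ T) x z ↔ ∃ y, Maps T x y ∧ Maps S y z := by
  have key : ∀ (hx : x ∈ T.domain) (hc : x ∈ (S ∘ₚ T).domain) (hS : T ⟨x, hx⟩ ∈ S.domain),
      (S ∘ₚ T) ⟨x, hc⟩ = S ⟨T ⟨x, hx⟩, hS⟩ := fun hx hc hS => rfl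
  constructor
  · intro h
    obtain ⟨hc, hz⟩ := maps_iff.1 h
    obtain ⟨⟨w, hw, hwx⟩, hx⟩ := Submodule.mem_inf.1 hc
    have hwx' : w = ⟨x, hx⟩ := Subtype.ext hwx
    subst hwx'
    refine ⟨T ⟨x, hx⟩, maps_apply T ⟨x, hx⟩, maps_iff.2 ⟨hw, ?_⟩⟩
    rw [← hz]
    exact (key hx hc hw).symm
  · rintro ⟨y, hT, hS⟩
    obtain ⟨hx, rfl⟩ := maps_iff.1 hT
    obtain ⟨hy, rfl⟩ := maps_iff.1 hS
    exact maps_iff.2 ⟨Submodule.mem_inf.2 ⟨⟨⟨x, hx⟩, hy, rfl⟩, hx⟩, key _ _ _⟩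

lemma maps_add {S T : E →ₗ.[ℂ] F} {x : E} {z : F} :
    Maps (S + T) x z ↔ ∃ a b, Maps S x a ∧ Maps T x b ∧ z = a + b := by
  constructor
  · intro h
    obtain ⟨hx, rfl⟩ := maps_iff.1 h
    exact ⟨_, _, maps_apply S ⟨x, hx.1⟩, maps_apply T ⟨x, hx.2⟩, rfl⟩
  · rintro ⟨a, b, ha, hb, rfl⟩
    obtain ⟨h1, rfl⟩ := maps_iff.1 ha
    obtain ⟨h2, rfl⟩ := maps_iff.1 hb
    exact maps_iff.2 ⟨⟨h1, h2⟩, rfl⟩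

lemma maps_sub {S T : E →ₗ.[ℂ] F} {x : E} {z : F} :
    Maps (S - T) x z ↔ ∃ a b, Maps S x a ∧ Maps T x b ∧ z = a - b := by
  constructor
  · intro h
    obtain ⟨hx, rfl⟩ := maps_iff.1 h
    exact ⟨_, _, maps_apply S ⟨x, hx.1⟩, maps_apply T ⟨x, hx.2⟩, rfl⟩
  · rintro ⟨a, b, ha, hb, rfl⟩
    obtain ⟨h1, rfl⟩ := maps_iff.1 ha
    obtain ⟨h2, rfl⟩ := maps_iff.1 hb
    exact maps_iff.2 ⟨⟨h1, h2⟩, rfl⟩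

lemma maps_smul {c : ℂ} {T : E →ₗ.[ℂ] F} {x : E} {z : F} :
    Maps (c • T) x z ↔ ∃ y, Maps T x y ∧ z = c • y := by
  constructor
  · intro h
    obtain ⟨hx, rfl⟩ := maps_iff.1 h
    exact ⟨_, maps_apply T ⟨x, hx⟩, rfl⟩
  · rintro ⟨y, hy, rfl⟩
    obtain ⟨hx, rfl⟩ := maps_iff.1 hy
    exact maps_iff.2 ⟨hx, rfl⟩

lemma maps_toPMap {X : E →ₗ[ℂ] F} {x : E} {y : F} : Maps (X.toPMap ⊤) x y ↔ y = X x := by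
  rw [maps_iff]
  exact ⟨fun ⟨_, h⟩ => h.symm, fun h => ⟨trivial, h.symm⟩⟩

lemma maps_pid {x y : E} : Maps (pid E) x y ↔ y = x := maps_toPMap

lemma maps_toLinearPMap {g : Submodule ℂ (E × F)} (hg : ∀ z ∈ g, z.1 = 0 → z.2 = 0)
    {x : E} {y : F} : Maps g.toLinearPMap x y ↔ (x, y) ∈ g := by
  unfold Maps
  rw [Submodule.toLinearPMap_graph_eq g hg]

lemma maps_ppow_succ {T : E →ₗ.[ℂ] E} {n : ℕ} {x z : E} :
    Maps (ppow T (n + 1)) x z ↔ ∃ y, Maps T x y ∧ Maps (ppow T n) y z := by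
  induction n generalizing z with
  | zero =>
    simp only [ppow, maps_comp, maps_pid]
    exact ⟨fun ⟨y, h, h'⟩ => ⟨z, h ▸ h', rfl⟩, fun ⟨y, h, h'⟩ => ⟨x, rfl, h' ▸ h⟩⟩
  | succ n ih =>
    rw [ppow, maps_comp]
    simp only [ih]
    constructor
    · rintro ⟨y, ⟨w, h1, h2⟩, h3⟩
      exact ⟨w, h1, by rw [ppow, maps_comp]; exact ⟨y, h2, h3⟩⟩
    · rintro ⟨w, h1, h2⟩
      rw [ppow, maps_comp] at h2
      obtain ⟨y, h2, h3⟩ := h2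
      exact ⟨y, ⟨w, h1, h2⟩, h3⟩

lemma le_of_maps {S T : E →ₗ.[ℂ] F} (h : ∀ x y, Maps S x y → Maps T x y) : S ≤ T :=
  LinearPMap.le_of_le_graph fun ⟨x, y⟩ hxy => h x y hxy

/-- Two operators that are both defined on every vector, with a common value, are equal. -/
lemma eq_of_forall_exists_maps {S T : E →ₗ.[ℂ] F} (h : ∀ x, ∃ y, Maps S x y ∧ Maps T x y) :
    S.domain = ⊤ ∧ S = T := by
  refine ⟨eq_top_iff.2 fun x _ => ?_, LinearPMap.eq_of_eq_graph (Submodule.ext ?_)⟩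
  · obtain ⟨y, hy, -⟩ := h x
    exact hy.mem_domain
  · rintro ⟨x, y⟩
    obtain ⟨z, h1, h2⟩ := h x
    constructor
    · intro hy
      exact (Maps.unique h1 hy) ▸ h2
    · intro hy
      exact (Maps.unique h2 hy) ▸ h1

/-- An everywhere defined partial operator is a linear map. -/
lemma exists_eq_toPMap {T : E →ₗ.[ℂ] F} (h : ∀ x, ∃ y, Maps T x y) :
    ∃ X : E →ₗ[ℂ] F, T = X.toPMap ⊤ := by
  have hd : ∀ x, x ∈ T.domain := fun x => (h x).choose_spec.mem_domain
  refine ⟨T.toFun ∘ₗ LinearMap.id.codRestrict T.domain hd, ?_⟩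
  refine (eq_of_forall_exists_maps fun x => ?_).2
  exact ⟨T ⟨x, hd x⟩, maps_apply T ⟨x, hd x⟩, maps_toPMap.2 rfl⟩

end Maps

/-! ### The algebra of the Feshbach map -/

section FeshbachAlgebra

variable {𝓗 : Type*} [NormedAddCommGroup 𝓗] [InnerProductSpace ℂ 𝓗]

/-- The inverse is well behaved as soon as `T` is injective on `K`. -/
lemma maps_invOn {T : 𝓗 →ₗ.[ℂ] 𝓗} {K : Submodule ℂ 𝓗} (hinj : ∀ x ∈ K, Maps T x 0 → x = 0)
    {x y : 𝓗} : Maps (invOn T K) y x ↔ x ∈ K ∧ Maps T x y := by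
  have hr : ∀ {a b : 𝓗}, Maps (T.domRestrict K) a b ↔ a ∈ K ∧ Maps T a b := by
    intro a b
    constructor
    · intro h
      obtain ⟨ha, rfl⟩ := maps_iff.1 h
      exact ⟨ha.1, maps_apply T ⟨a, ha.2⟩⟩
    · rintro ⟨h1, h2⟩
      obtain ⟨ha, rfl⟩ := maps_iff.1 h2
      exact maps_iff.2 ⟨⟨h1, ha⟩, rfl⟩
  have hker : (T.domRestrict K).toFun.ker = ⊥ := by
    rw [LinearMap.ker_eq_bot']
    intro a ha
    have h2 := maps_apply (T.domRestrict K) a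
    rw [← LinearPMap.toFun_eq_coe, ha] at h2
    exact Subtype.ext (hinj _ (hr.1 h2).1 (hr.1 h2).2)
  rw [← hr]
  unfold invOn Maps
  rw [LinearPMap.inverse_graph hker]
  constructor
  · rintro ⟨⟨a, b⟩, h, h'⟩
    obtain ⟨rfl, rfl⟩ : b = y ∧ a = x := by simpa using h'
    exact h
  · intro h
    exact ⟨(x, y), h, rfl⟩

lemma BoundedInvertibleOn.eq_zero {T : 𝓗 →ₗ.[ℂ] 𝓗} {K : Submodule ℂ 𝓗}
    (h : BoundedInvertibleOn T K) {x : 𝓗} (hx : x ∈ K) (h0 : Maps T x 0) : x = 0 := by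
  obtain ⟨C, hC⟩ := h.bounded
  obtain ⟨hd, h0⟩ := maps_iff.1 h0
  have := hC ⟨x, hd⟩ hx
  rw [h0, norm_zero, mul_zero] at this
  exact norm_le_zero_iff.1 this

variable {H τ : 𝓗 →ₗ.[ℂ] 𝓗} {X Xb : 𝓗 →ₗ[ℂ] 𝓗}

lemma mem_ran (x : 𝓗) : Xb x ∈ ran (Xb.toPMap ⊤) :=
  Submodule.le_topologicalClosure _ ⟨⟨x, trivial⟩, rfl⟩

namespace FeshbachPair

lemma exists_maps_chi (P : FeshbachPair H τ (X.toPMap ⊤) (Xb.toPMap ⊤)) (x : 𝓗) :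
    ∃ h t, Maps H (X x) h ∧ Maps τ (X x) t := by
  have hx : x ∈ (H ∘ₚ X.toPMap ⊤).domain := by rw [P.domain_χ]; trivial
  obtain ⟨y, hy⟩ := mem_domain_iff_maps.1 hx
  obtain ⟨z, hz, hy⟩ := maps_comp.1 hy
  obtain rfl := maps_toPMap.1 hz
  obtain ⟨t, ht⟩ := mem_domain_iff_maps.1 (P.domain_le hy.mem_domain)
  exact ⟨y, t, hy, ht⟩

lemma exists_maps_chib (P : FeshbachPair H τ (X.toPMap ⊤) (Xb.toPMap ⊤)) {x y : 𝓗}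
    (h : Maps H x y) : ∃ h t, Maps H (Xb x) h ∧ Maps τ (Xb x) t := by
  obtain ⟨y, hy⟩ := mem_domain_iff_maps.1 (P.domain_χb h.mem_domain)
  obtain ⟨z, hz, hy⟩ := maps_comp.1 hy
  obtain rfl := maps_toPMap.1 hz
  obtain ⟨t, ht⟩ := mem_domain_iff_maps.1 (P.domain_le hy.mem_domain)
  exact ⟨y, t, hy, ht⟩

lemma exists_maps_tau (P : FeshbachPair H τ (X.toPMap ⊤) (Xb.toPMap ⊤)) {x y : 𝓗}
    (h : Maps H x y) : ∃ t, Maps τ x t :=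
  mem_domain_iff_maps.1 (P.domain_le h.mem_domain)

lemma tau_chi (P : FeshbachPair H τ (X.toPMap ⊤) (Xb.toPMap ⊤)) {x t : 𝓗}
    (h : Maps τ x t) : Maps τ (X x) (X t) := by
  have := LinearPMap.le_graph_of_le P.comm_χ (show Maps _ x (X t) from
    maps_comp.2 ⟨t, h, maps_toPMap.2 rfl⟩)
  obtain ⟨z, hz, h⟩ := maps_comp.1 this
  obtain rfl := maps_toPMap.1 hz
  exact h

lemma tau_chib (P : FeshbachPair H τ (X.toPMap ⊤) (Xb.toPMap ⊤)) {x t : 𝓗}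
    (h : Maps τ x t) : Maps τ (Xb x) (Xb t) := by
  have := LinearPMap.le_graph_of_le P.comm_χb (show Maps _ x (Xb t) from
    maps_comp.2 ⟨t, h, maps_toPMap.2 rfl⟩)
  obtain ⟨z, hz, h⟩ := maps_comp.1 this
  obtain rfl := maps_toPMap.1 hz
  exact h

lemma maps_Hbar {x y : 𝓗} : Maps (Hbar H τ (Xb.toPMap ⊤)) x y ↔
    ∃ t h s, Maps τ x t ∧ Maps H (Xb x) h ∧ Maps τ (Xb x) s ∧ y = t + Xb (h - s) := by
  simp only [Hbar, maps_add, maps_comp, maps_sub, maps_toPMap]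
  constructor
  · rintro ⟨a, b, ha, ⟨-, ⟨-, rfl, h, s, h1, h2, rfl⟩, rfl⟩, rfl⟩
    exact ⟨a, h, s, ha, h1, h2, rfl⟩
  · rintro ⟨t, h, s, h1, h2, h3, rfl⟩
    exact ⟨t, _, h1, ⟨_, ⟨_, rfl, h, s, h2, h3, rfl⟩, rfl⟩, rfl⟩

lemma maps_Rbar (P : FeshbachPair H τ (X.toPMap ⊤) (Xb.toPMap ⊤)) {x y : 𝓗} :
    Maps (Rbar H τ (Xb.toPMap ⊤)) y x ↔
      x ∈ ran (Xb.toPMap ⊤) ∧ Maps (Hbar H τ (Xb.toPMap ⊤)) x y :=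
  maps_invOn fun _ hx h => P.inv_Hbar.eq_zero hx h

/-- `R̄ χ̄` is everywhere defined, and `ω χ̄` is defined on its range. -/
lemma exists_maps_Rbar (P : FeshbachPair H τ (X.toPMap ⊤) (Xb.toPMap ⊤)) (x : 𝓗) :
    ∃ y t h s, Maps (Rbar H τ (Xb.toPMap ⊤)) (Xb x) y ∧ Maps τ y t ∧ Maps H (Xb y) h ∧
      Maps τ (Xb y) s ∧ Xb x = t + Xb (h - s) := by
  obtain ⟨⟨y, hd⟩, hy, h⟩ := P.inv_Hbar.surj (Xb x) (mem_ran x)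
  have hm : Maps (Hbar H τ (Xb.toPMap ⊤)) y (Xb x) := maps_iff.2 ⟨hd, h⟩
  obtain ⟨t, h, s, h1, h2, h3, h4⟩ := maps_Hbar.1 hm
  exact ⟨y, t, h, s, P.maps_Rbar.2 ⟨hy, hm⟩, h1, h2, h3, h4⟩

end FeshbachPair

lemma maps_feshQ {x q : 𝓗} : Maps (feshQ H τ (X.toPMap ⊤) (Xb.toPMap ⊤)) x q ↔
    ∃ h s y, Maps H (X x) h ∧ Maps τ (X x) s ∧ Maps (Rbar H τ (Xb.toPMap ⊤)) (Xb (h - s)) y ∧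
      q = X x - Xb y := by
  simp only [feshQ, maps_comp, maps_sub, maps_toPMap]
  constructor
  · rintro ⟨-, b, rfl, ⟨y, ⟨-, ⟨-, ⟨-, rfl, h, s, h1, h2, rfl⟩, rfl⟩, hy⟩, rfl⟩, rfl⟩
    exact ⟨h, s, y, h1, h2, hy, rfl⟩
  · rintro ⟨h, s, y, h1, h2, hy, rfl⟩
    exact ⟨_, _, rfl, ⟨y, ⟨_, ⟨_, ⟨_, rfl, h, s, h1, h2, rfl⟩, rfl⟩, hy⟩, rfl⟩, rfl⟩

lemma maps_feshQs {x q : 𝓗} : Maps (feshQs H τ (X.toPMap ⊤) (Xb.toPMap ⊤)) x q ↔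
    ∃ y h s, Maps (Rbar H τ (Xb.toPMap ⊤)) (Xb x) y ∧ Maps H (Xb y) h ∧ Maps τ (Xb y) s ∧
      q = X x - X (h - s) := by
  simp only [feshQs, maps_comp, maps_sub, maps_toPMap]
  constructor
  · rintro ⟨-, b, rfl, ⟨-, ⟨-, ⟨y, ⟨-, rfl, hy⟩, rfl⟩, h, s, h1, h2, rfl⟩, rfl⟩, rfl⟩
    exact ⟨y, h, s, hy, h1, h2, rfl⟩
  · rintro ⟨y, h, s, hy, h1, h2, rfl⟩
    exact ⟨_, _, rfl, ⟨_, ⟨_, ⟨y, ⟨_, rfl, hy⟩, rfl⟩, h, s, h1, h2, rfl⟩, rfl⟩, rfl⟩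

lemma maps_feshbach {x z : 𝓗} : Maps (feshbach H τ (X.toPMap ⊤) (Xb.toPMap ⊤)) x z ↔
    ∃ t h s y h' s', Maps τ x t ∧ Maps H (X x) h ∧ Maps τ (X x) s ∧
      Maps (Rbar H τ (Xb.toPMap ⊤)) (Xb (h - s)) y ∧ Maps H (Xb y) h' ∧ Maps τ (Xb y) s' ∧
      z = t + X (h - s) - X (h' - s') := by
  simp only [feshbach, maps_comp, maps_sub, maps_add, maps_toPMap]
  constructor
  · rintro ⟨-, -, ⟨t, -, ht, ⟨-, ⟨-, rfl, h, s, h1, h2, rfl⟩, rfl⟩, rfl⟩,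
      ⟨-, ⟨-, ⟨y, ⟨-, ⟨-, ⟨-, rfl, h0, s0, h3, h4, rfl⟩, rfl⟩, hy⟩, rfl⟩,
        h', s', h5, h6, rfl⟩, rfl⟩, rfl⟩
    obtain rfl := h1.unique h3
    obtain rfl := h2.unique h4
    exact ⟨t, h, s, y, h', s', ht, h1, h2, hy, h5, h6, rfl⟩
  · rintro ⟨t, h, s, y, h', s', ht, h1, h2, hy, h5, h6, rfl⟩
    exact ⟨_, _, ⟨t, _, ht, ⟨_, ⟨_, rfl, h, s, h1, h2, rfl⟩, rfl⟩, rfl⟩,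
      ⟨_, ⟨_, ⟨y, ⟨_, ⟨_, ⟨_, rfl, h, s, h1, h2, rfl⟩, rfl⟩, hy⟩, rfl⟩,
        h', s', h5, h6, rfl⟩, rfl⟩, rfl⟩

/-- `F_χ(H, τ) = τ` up to a term with values in the range of `χ`. -/
lemma feshbach_eq_tau_add {x z : 𝓗} (h : Maps (feshbach H τ (X.toPMap ⊤) (Xb.toPMap ⊤)) x z) :
    ∃ t a, Maps τ x t ∧ z = t + X a := by
  obtain ⟨t, k, s, y, k', s', ht, -, -, -, -, -, rfl⟩ := maps_feshbach.1 h
  exact ⟨t, (k - s) - (k' - s'), ht, by rw [map_sub X (k - s)]; abel⟩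

namespace FeshbachPair

variable (P : FeshbachPair H τ (X.toPMap ⊤) (Xb.toPMap ⊤))
  (hcomm : ∀ x, X (Xb x) = Xb (X x)) (hsq : ∀ x, X (X x) + Xb (Xb x) = x)

include P hsq in
/-- `H Q_χ = χ F_χ` on the domain of `τ`. -/
theorem H_feshQ {x t : 𝓗} (hx : Maps τ x t) :
    ∃ q z, Maps (feshQ H τ (X.toPMap ⊤) (Xb.toPMap ⊤)) x q ∧
      Maps (feshbach H τ (X.toPMap ⊤) (Xb.toPMap ⊤)) x z ∧ Maps H q (X z) := by
  obtain ⟨h, s, h1, h2⟩ := P.exists_maps_chi x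
  obtain ⟨y, t', h', s', hR, ht', h1', h2', e⟩ := P.exists_maps_Rbar (h - s)
  refine ⟨_, _, maps_feshQ.2 ⟨h, s, y, h1, h2, hR, rfl⟩,
    maps_feshbach.2 ⟨t, h, s, y, h', s', hx, h1, h2, hR, h1', h2', rfl⟩, ?_⟩
  refine (h1.sub h1').congr rfl ?_
  obtain rfl := h2.unique (P.tau_chi hx)
  obtain rfl := h2'.unique (P.tau_chib ht')
  have e2 := congrArg Xb e
  have e3 := hsq (h - X t)
  have e4 := hsq (h' - Xb t')
  simp only [map_sub, map_add] at e2 e3 e4 ⊢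
  linear_combination (norm := module) e4 - e3 + e2

include P hsq in
/-- `Q_χ^♯ H = F_χ χ` on the domain of `H`. -/
theorem feshQs_H {x h : 𝓗} (hx : Maps H x h) :
    ∃ z, Maps (feshQs H τ (X.toPMap ⊤) (Xb.toPMap ⊤)) h z ∧
      Maps (feshbach H τ (X.toPMap ⊤) (Xb.toPMap ⊤)) (X x) z := by
  obtain ⟨t, ht⟩ := P.exists_maps_tau hx
  obtain ⟨hb, -, hhb, -⟩ := P.exists_maps_chib hx
  have htb := P.tau_chib ht
  obtain ⟨hbb, -, hhbb, -⟩ := P.exists_maps_chib hhb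
  have htbb := P.tau_chib htb
  have hxx : x - Xb (Xb x) = X (X x) := by rw [sub_eq_iff_eq_add, hsq]
  have htt : t - Xb (Xb t) = X (X t) := by rw [sub_eq_iff_eq_add, hsq]
  have hH := (hx.sub hhbb).congr hxx rfl
  have hT := P.tau_chi (P.tau_chi ht)
  obtain ⟨y, t', h', s', hR, ht', h1', h2', e⟩ := P.exists_maps_Rbar h
  -- `χ̄ ω χ² = χ̄ H - H_χ̄ χ̄`, so `R̄ χ̄ ω χ² = R̄ χ̄ H - χ̄`
  have hR2 : Maps (Rbar H τ (Xb.toPMap ⊤)) (Xb ((h - hbb) - X (X t))) (y - Xb x) := by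
    have hb : Maps (Rbar H τ (Xb.toPMap ⊤)) (Xb t + Xb (hbb - Xb (Xb t))) (Xb x) :=
      P.maps_Rbar.2 ⟨mem_ran x, maps_Hbar.2 ⟨_, _, _, htb, hhbb, htbb, rfl⟩⟩
    refine (hR.sub hb).congr ?_ rfl
    rw [← htt, ← map_add, ← map_sub]
    congr 1
    abel
  refine ⟨_, maps_feshQs.2 ⟨y, h', s', hR, h1', h2', rfl⟩,
    maps_feshbach.2 ⟨_, _, _, _, _, _, P.tau_chi ht, hH, hT, hR2,
      (h1'.sub hhbb).congr (map_sub Xb y (Xb x)).symm rfl,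
      (h2'.sub htbb).congr (map_sub Xb y (Xb x)).symm rfl, ?_⟩⟩
  rw [← htt]
  simp only [map_sub]
  abel

include P hcomm hsq in
/-- `Q_χ^♯ χ = 1 - F_χ χ̄ τ⁻¹ χ̄`; combined with `H Q_χ = χ F_χ` this computes `Q_χ^♯ H Q_χ`. The
vector `τ⁻¹ χ̄ z` is given in the form `χ̄ v`. -/
theorem feshQs_chi {z v : 𝓗} (hv : Maps τ (Xb v) (Xb z)) :
    ∃ c, Maps (feshQs H τ (X.toPMap ⊤) (Xb.toPMap ⊤)) (X z) (z - c) ∧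
      Maps (feshbach H τ (X.toPMap ⊤) (Xb.toPMap ⊤)) (Xb (Xb v)) c := by
  obtain ⟨y, t', h', s', hR, ht', h1', h2', e⟩ := P.exists_maps_Rbar (X z)
  have hvb := P.tau_chib hv
  obtain ⟨h, -, hh, -⟩ := P.exists_maps_chi (Xb (Xb v))
  have hs := P.tau_chi hvb
  have hcc : X (Xb (Xb v)) = Xb (X (Xb v)) := hcomm _
  -- `H_χ̄ χ w = τ χ w + χ̄ ω χ̄ χ w` for `w = τ⁻¹ χ̄ z`, so `R̄ χ̄ ω χ χ̄ w = χ w - R̄ χ χ̄ z`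
  have hR2 : Maps (Rbar H τ (Xb.toPMap ⊤)) (Xb (h - X (Xb (Xb z)))) (X (Xb v) - y) := by
    have hb : Maps (Rbar H τ (Xb.toPMap ⊤))
        (X (Xb z) + Xb (h - X (Xb (Xb z)))) (X (Xb v)) :=
      P.maps_Rbar.2 ⟨by rw [hcomm]; exact mem_ran _,
        maps_Hbar.2 ⟨_, _, _, P.tau_chi hv, hh.congr hcc rfl, hs.congr hcc rfl, rfl⟩⟩
    refine (hb.sub hR).congr ?_ rfl
    rw [hcomm z]
    abel
  refine ⟨_, ?_, maps_feshbach.2 ⟨_, _, _, _, _, _, hvb, hh, hs, hR2,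
      (hh.sub h1').congr (by rw [map_sub, hcc]) rfl,
      (hs.sub h2').congr (by rw [map_sub, hcc]) rfl, rfl⟩⟩
  refine maps_feshQs.2 ⟨y, h', s', hR, h1', h2', ?_⟩
  have e1 := hsq z
  simp only [map_sub]
  linear_combination (norm := module) - e1

end FeshbachPair

end FeshbachAlgebra

/-! ### Functions of the field energy and dilatations -/

lemma FullFock.ext_ae {ψ φ : FullFock} (h : ∀ n, ∀ᵐ K ∂confMeasure n, ψ n K = φ n K) : ψ = φ :=
  lp.ext (funext fun n => Lp.ext (h n))

/-- `φ = f(H_f) ψ`. -/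
def EMul (f : ℝ → ℝ) (ψ φ : FullFock) : Prop :=
  ∀ n, ∀ᵐ K ∂confMeasure n, φ n K = (f (energy K) : ℂ) * ψ n K

/-- `φ = Γ_r ψ`. -/
def Dil (r : ℝ) (ψ φ : FullFock) : Prop :=
  ∀ n : ℕ, ∀ᵐ K ∂confMeasure n, φ n K = ((r ^ (3 * (n : ℝ) / 2) : ℝ) : ℂ) * ψ n (scale r K)

/-- `ψ` lies in the range of `1[H_f < s]`. -/
def SuppBelow (s : ℝ) (ψ : FullFock) : Prop :=
  ∀ n, ∀ᵐ K ∂confMeasure n, s ≤ energy K → ψ n K = 0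

lemma maps_fnHf {V W : Submodule ℂ FullFock} {f : ℝ → ℝ} {x : V} {y : W} :
    Maps (fnHf V W f) x y ↔ EMul f x y := by
  refine maps_toLinearPMap ?_
  rintro ⟨a, b⟩ h h0
  obtain rfl : a = 0 := h0
  refine Subtype.ext (FullFock.ext_ae fun n => ?_)
  filter_upwards [h n, coe_zero_ae n] with K h1 h2
  simp only [Submodule.coe_zero] at h1 ⊢
  rw [h1, h2, mul_zero]

lemma maps_dil {V W : Submodule ℂ FullFock} {r : ℝ} {hr : 0 < r} {x : V} {y : W} :
    Maps (dil V W r hr) x y ↔ Dil r x y := by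
  refine maps_toLinearPMap ?_
  rintro ⟨a, b⟩ h h0
  obtain rfl : a = 0 := h0
  refine Subtype.ext (FullFock.ext_ae fun n => ?_)
  filter_upwards [h n, coe_zero_ae n, (quasi_scale hr.ne' n).ae (coe_zero_ae n)] with K h1 h2 h3
  simp only [Submodule.coe_zero] at h1 ⊢
  rw [h1, h2, h3, mul_zero]

lemma maps_ident {V W : Submodule ℂ FullFock} {x : V} {y : W} :
    Maps (ident V W) x y ↔ (y : FullFock) = x := by
  rw [ident, maps_fnHf]
  constructor
  · intro h
    refine FullFock.ext_ae fun n => ?_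
    filter_upwards [h n] with K hK
    rw [hK, Complex.ofReal_one, one_mul]
  · intro h n
    rw [h]
    simp

lemma energy_nonneg {n : ℕ} (K : Conf n) : 0 ≤ energy K :=
  Finset.sum_nonneg fun _ _ => norm_nonneg _

lemma energy_scale {r : ℝ} (hr : 0 ≤ r) {n : ℕ} (K : Conf n) :
    energy (scale r K) = r * energy K := by
  simp [energy, scale, norm_smul, abs_of_nonneg hr, Finset.mul_sum]

lemma energy_perm {n : ℕ} (π : Equiv.Perm (Fin n)) (K : Conf n) :
    energy (K ∘ π) = energy K :=
  Equiv.sum_comp π fun j => ‖(K j).1‖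

lemma continuous_energy (n : ℕ) : Continuous (energy : Conf n → ℝ) := by
  unfold energy; fun_prop

lemma scale_inv_scale {r : ℝ} (hr : r ≠ 0) {n : ℕ} (K : Conf n) : scale r (scale r⁻¹ K) = K := by
  funext j
  simp [scale, smul_smul, hr]

/-! #### Commutation rules and supports -/

namespace EMul

variable {f g h : ℝ → ℝ} {ψ φ η : FullFock}

lemma unique (h1 : EMul f ψ φ) (h2 : EMul f ψ η) : φ = η :=
  FullFock.ext_ae fun n => by
    filter_upwards [h1 n, h2 n] with K a b
    rw [a, b]

lemma congr (h1 : EMul f ψ φ) (hfg : ∀ x, 0 ≤ x → f x = g x) : EMul g ψ φ := fun n => by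
  filter_upwards [h1 n] with K a
  rw [a, hfg _ (energy_nonneg K)]

lemma comp (h1 : EMul f ψ φ) (h2 : EMul g φ η) : EMul (fun x => g x * f x) ψ η := fun n => by
  filter_upwards [h1 n, h2 n] with K a b
  rw [b, a, Complex.ofReal_mul, mul_assoc]

lemma smul (h1 : EMul f ψ φ) (c : ℂ) : EMul f (c • ψ) (c • φ) := fun n => by
  filter_upwards [h1 n, coe_smul_ae c ψ n, coe_smul_ae c φ n] with K a b d
  rw [d, a, b]; ring

lemma const_mul (h1 : EMul f ψ φ) (c : ℝ) : EMul (fun x => c * f x) ψ ((c : ℂ) • φ) := fun n => by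
  filter_upwards [h1 n, coe_smul_ae (c : ℂ) φ n] with K a d
  rw [d, a, Complex.ofReal_mul]; ring

lemma eq_zero (h1 : EMul f ψ φ) {s : ℝ} (hψ : SuppBelow s ψ) (hf : ∀ x, 0 ≤ x → x < s → f x = 0) :
    φ = 0 :=
  FullFock.ext_ae fun n => by
    filter_upwards [h1 n, hψ n, coe_zero_ae n] with K a b c
    rw [a, c]
    rcases lt_or_ge (energy K) s with hK | hK
    · rw [hf _ (energy_nonneg K) hK, Complex.ofReal_zero, zero_mul]
    · rw [b hK, mul_zero]

lemma suppBelow (h1 : EMul f ψ φ) {s : ℝ} (hψ : SuppBelow s ψ) : SuppBelow s φ := fun n => by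
  filter_upwards [h1 n, hψ n] with K a b hK
  rw [a, b hK, mul_zero]

lemma suppBelow_of_support (h1 : EMul f ψ φ) {s : ℝ} (hf : ∀ x, s ≤ x → f x = 0) :
    SuppBelow s φ := fun n => by
  filter_upwards [h1 n] with K a hK
  rw [a, hf _ hK, Complex.ofReal_zero, zero_mul]

lemma mem_Fock (h1 : EMul f ψ φ) (hψ : ψ ∈ Fock) : φ ∈ Fock := fun n π => by
  filter_upwards [h1 n, (quasi_perm π).ae (h1 n), hψ n π] with K a b c
  rw [a, b, energy_perm, c]

end EMul

namespace SuppBelow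

variable {ψ φ : FullFock} {s t : ℝ}

lemma mono (h : SuppBelow s ψ) (hst : s ≤ t) : SuppBelow t ψ := fun n => by
  filter_upwards [h n] with K a hK
  exact a (hst.trans hK)

lemma add (h : SuppBelow s ψ) (h' : SuppBelow s φ) : SuppBelow s (ψ + φ) := fun n => by
  filter_upwards [h n, h' n, coe_add_ae ψ φ n] with K a b c hK
  rw [c, a hK, b hK, add_zero]

end SuppBelow

namespace Dil

variable {r : ℝ} {ψ φ η ζ : FullFock} {f g : ℝ → ℝ}

lemma unique (h1 : Dil r ψ φ) (h2 : Dil r ψ η) : φ = η :=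
  FullFock.ext_ae fun n => by
    filter_upwards [h1 n, h2 n] with K a b
    rw [a, b]

lemma symm (hr : 0 < r) (h : Dil r ψ φ) : Dil r⁻¹ φ ψ := fun n => by
  filter_upwards [(quasi_scale (inv_ne_zero hr.ne') n).ae (h n)] with K a
  rw [a, scale_inv_scale hr.ne', ← mul_assoc, ← Complex.ofReal_mul,
    ← Real.mul_rpow (inv_nonneg.2 hr.le) hr.le, inv_mul_cancel₀ hr.ne', Real.one_rpow,
    Complex.ofReal_one, one_mul]

lemma smul (hr : 0 < r) (h : Dil r ψ φ) (c : ℂ) : Dil r (c • ψ) (c • φ) := fun n => by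
  filter_upwards [h n, (quasi_scale hr.ne' n).ae (coe_smul_ae c ψ n), coe_smul_ae c φ n]
    with K a b d
  rw [d, a, b]; ring

/-- `Γ_r g(H_f) = g(r H_f) Γ_r`. -/
lemma emul (hr : 0 < r) (h : Dil r ψ φ) (hg : EMul g ψ ζ) (hf : EMul f φ η)
    (hfg : ∀ x, 0 ≤ x → g (r * x) = f x) : Dil r ζ η := fun n => by
  filter_upwards [h n, hf n, (quasi_scale hr.ne' n).ae (hg n)] with K a b c
  rw [b, a, c, energy_scale hr.le, hfg _ (energy_nonneg K)]; ring

lemma suppBelow (hr : 0 < r) (h : Dil r ψ φ) {s : ℝ} (hψ : SuppBelow (r * s) ψ) :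
    SuppBelow s φ := fun n => by
  filter_upwards [h n, (quasi_scale hr.ne' n).ae (hψ n)] with K a b hK
  rw [a, b (by rw [energy_scale hr.le]; exact mul_le_mul_of_nonneg_left hK hr.le), mul_zero]

lemma mem_Fock (hr : 0 < r) (h : Dil r ψ φ) (hψ : ψ ∈ Fock) : φ ∈ Fock := fun n π => by
  filter_upwards [h n, (quasi_perm π).ae (h n), (quasi_scale hr.ne' n).ae (hψ n π)] with K a b c
  rw [a, b, ← c]
  rfl

end Dil

/-! #### Boundedness -/

lemma exists_fullFock_of_norm_le (ψ : FullFock) {C : ℝ}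
    (g : ∀ n, Lp ℂ 2 (confMeasure n)) (hg : ∀ n, ‖g n‖ ≤ C * ‖ψ n‖) :
    ∃ φ : FullFock, ∀ n, φ n = g n := by
  have h2 : (0 : ℝ) < (2 : ENNReal).toReal := by norm_num
  have hm : Memℓp g 2 := by
    refine memℓp_gen ?_
    refine Summable.of_nonneg_of_le (fun n => by positivity) (fun n => ?_)
      (((lp.memℓp ψ).summable h2).mul_left ((|C|) ^ (2 : ENNReal).toReal))
    rw [← Real.mul_rpow (abs_nonneg C) (norm_nonneg _)]
    refine Real.rpow_le_rpow (norm_nonneg _) ((hg n).trans ?_) h2.le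
    exact mul_le_mul_of_nonneg_right (le_abs_self C) (norm_nonneg _)
  exact ⟨⟨g, hm⟩, fun n => rfl⟩

/-- Functions `f` for which `f(H_f)` is a bounded operator. Only the values on `[0, ∞)` matter. -/
structure EnergyBounded (f : ℝ → ℝ) : Prop where
  measurable : ∀ n, Measurable fun K : Conf n => f (energy K)
  bounded : ∃ C, ∀ x, 0 ≤ x → |f x| ≤ C

lemma EnergyBounded.exists_emul {f : ℝ → ℝ} (hf : EnergyBounded f) (ψ : FullFock) :
    ∃ φ, EMul f ψ φ := by
  obtain ⟨C, hC⟩ := hf.bounded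
  have hle : ∀ n, ∀ᵐ K ∂confMeasure n, ‖(f (energy K) : ℂ) * ψ n K‖ ≤ C * ‖ψ n K‖ := fun n =>
    Eventually.of_forall fun K => by
      rw [norm_mul, Complex.norm_real, Real.norm_eq_abs]
      exact mul_le_mul_of_nonneg_right (hC _ (energy_nonneg K)) (norm_nonneg _)
  have hm : ∀ n, MemLp (fun K => (f (energy K) : ℂ) * ψ n K) 2 (confMeasure n) := fun n =>
    MemLp.of_le_mul (Lp.memLp (ψ n))
      (((Complex.measurable_ofReal.comp (hf.measurable n)).aestronglyMeasurable).mul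
        (Lp.aestronglyMeasurable (ψ n))) (hle n)
  obtain ⟨φ, hφ⟩ := exists_fullFock_of_norm_le ψ (C := C) (fun n => (hm n).toLp _) fun n => by
    refine Lp.norm_le_mul_norm_of_ae_le_mul ?_
    filter_upwards [(hm n).coeFn_toLp, hle n] with K h1 h2
    rw [h1]
    exact h2
  refine ⟨φ, fun n => ?_⟩
  rw [hφ n]
  exact (hm n).coeFn_toLp

lemma EnergyBounded.mul {f g : ℝ → ℝ} (hf : EnergyBounded f) (hg : EnergyBounded g) :
    EnergyBounded fun x => f x * g x := by
  obtain ⟨C, hC⟩ := hf.bounded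
  obtain ⟨D, hD⟩ := hg.bounded
  refine ⟨fun n => (hf.measurable n).mul (hg.measurable n), C * D, fun x hx => ?_⟩
  rw [abs_mul]
  exact mul_le_mul (hC x hx) (hD x hx) (abs_nonneg _) ((abs_nonneg _).trans (hC x hx))

lemma map_scale {r : ℝ} (hr : 0 < r) (n : ℕ) :
    (confMeasure n).map (scale r) = Real.toNNReal (r ^ 3)⁻¹ ^ n • confMeasure n := by
  have hmf : Measurable (fun K : Photon => ((r • K.1, K.2) : Photon)) := by fun_prop
  have h1 : photonMeasure.map (fun K : Photon => ((r • K.1, K.2) : Photon))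
      = Real.toNNReal (r ^ 3)⁻¹ • photonMeasure := by
    have h := Measure.map_prod_map (volume : Measure Mom) (Measure.count : Measure Bool)
      (f := fun k : Mom => r • k) (g := id) (by fun_prop) measurable_id
    rw [Measure.map_addHaar_smul _ hr.ne', Measure.map_id, Measure.prod_smul_left] at h
    have h3 : |(r ^ Module.finrank ℝ Mom)⁻¹| = (r ^ 3)⁻¹ := by
      rw [finrank_euclideanSpace_fin, abs_of_nonneg (by positivity)]
    rw [h3] at h
    exact h.symm
  have hfs : ∀ _ : Fin n, SigmaFinite
      (photonMeasure.map (fun K : Photon => ((r • K.1, K.2) : Photon))) := by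
    intro _; rw [h1]; infer_instance
  have h2 := Measure.pi_map_pi (μ := fun _ : Fin n => photonMeasure) (hμ := hfs)
    (f := fun _ K => ((r • K.1, K.2) : Photon)) (fun _ => hmf.aemeasurable)
  simp only [h1] at h2
  refine Eq.trans h2 (Measure.pi_eq fun s hs => ?_)
  simp only [confMeasure, Measure.smul_apply, Measure.pi_pi, ENNReal.smul_def, smul_eq_mul,
    Finset.prod_mul_distrib, Finset.prod_const, Finset.card_univ, Fintype.card_fin,
    ENNReal.coe_pow]

lemma exists_dil {r : ℝ} (hr : 0 < r) (ψ : FullFock) : ∃ φ, Dil r ψ φ := by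
  have hs : ∀ n, Measurable (scale r : Conf n → Conf n) := fun n => by
    unfold scale; fun_prop
  have hc : ∀ n : ℕ, Real.toNNReal (r ^ 3)⁻¹ ^ n ≠ 0 := fun n =>
    pow_ne_zero _ (by simpa using pow_pos hr 3)
  have hψ : ∀ n, MemLp (ψ n) 2 ((confMeasure n).map (scale r)) := fun n => by
    rw [map_scale hr]
    exact (Lp.memLp (ψ n)).smul_measure (by simp)
  have hm : ∀ n, MemLp (fun K => ψ n (scale r K)) 2 (confMeasure n) := fun n =>
    (hψ n).comp_of_map (hs n).aemeasurable
  have hN : ∀ n : ℕ, ‖(hm n).toLp _‖ = (r ^ (3 * (n : ℝ) / 2))⁻¹ * ‖ψ n‖ := fun n => by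
    have h1 : eLpNorm (fun K => ψ n (scale r K)) 2 (confMeasure n)
        = eLpNorm (ψ n) 2 ((confMeasure n).map (scale r)) :=
      (eLpNorm_map_measure (hψ n).1 (hs n).aemeasurable).symm
    rw [Lp.norm_toLp, h1, map_scale hr, eLpNorm_smul_measure_of_ne_zero' (hc n), ENNReal.smul_def,
      smul_eq_mul, ENNReal.toReal_mul, ENNReal.coe_toReal, NNReal.coe_rpow, NNReal.coe_pow,
      Real.coe_toNNReal _ (by positivity), ← Lp.norm_def]
    congr 1
    rw [← inv_pow, ← pow_mul, ← Real.rpow_natCast, ← Real.rpow_mul (by positivity),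
      Real.inv_rpow hr.le]
    congr 2
    push_cast
    norm_num
    ring
  obtain ⟨φ, hφ⟩ := exists_fullFock_of_norm_le ψ (C := 1)
    (fun n => ((r ^ (3 * (n : ℝ) / 2) : ℝ) : ℂ) • (hm n).toLp _) fun n => by
      rw [norm_smul, Complex.norm_real, Real.norm_of_nonneg (by positivity), hN, ← mul_assoc,
        mul_inv_cancel₀ (Real.rpow_pos_of_pos hr _).ne']
  refine ⟨φ, fun n => ?_⟩
  rw [hφ n]
  filter_upwards [Lp.coeFn_smul (((r ^ (3 * (n : ℝ) / 2) : ℝ) : ℂ)) ((hm n).toLp _),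
    (hm n).coeFn_toLp] with K h1 h2
  rw [h1, Pi.smul_apply, h2, smul_eq_mul]

/-! ### The energy cutoffs -/

/-- Functions of `H_f` leave `V` invariant. -/
def EnergyInvariant (V : Submodule ℂ FullFock) : Prop :=
  ∀ {f : ℝ → ℝ} {ψ φ : FullFock}, EMul f ψ φ → ψ ∈ V → φ ∈ V

lemma energyInvariant_Fock : EnergyInvariant Fock := fun h hψ => h.mem_Fock hψ

lemma energyInvariant_Hred : EnergyInvariant Hred := fun h hψ =>
  ⟨h.mem_Fock hψ.1, h.suppBelow hψ.2⟩

lemma EnergyBounded.exists_linearMap {f : ℝ → ℝ} (hf : EnergyBounded f)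
    {V : Submodule ℂ FullFock} (hV : EnergyInvariant V) :
    ∃ X : V →ₗ[ℂ] V, fnHf V V f = X.toPMap ⊤ ∧ ∀ x : V, EMul f x (X x) := by
  have h : ∀ x : V, ∃ y, Maps (fnHf V V f) x y := fun x => by
    obtain ⟨φ, hφ⟩ := hf.exists_emul x
    exact ⟨⟨φ, hV hφ x.2⟩, maps_fnHf.2 hφ⟩
  obtain ⟨X, hX⟩ := exists_eq_toPMap h
  refine ⟨X, hX, fun x => ?_⟩
  have hx : Maps (fnHf V V f) x (X x) := by rw [hX]; exact maps_toPMap.2 rfl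
  exact maps_fnHf.1 hx

lemma exists_maps_Hf_Hred (x : Hred) : ∃ t, Maps (Hf Hred) x t := by
  have hb : EnergyBounded fun x => min x 1 :=
    ⟨fun n => (continuous_energy n).measurable.min measurable_const, 1, fun x hx => by
      rw [abs_of_nonneg (le_min hx zero_le_one)]
      exact min_le_right _ _⟩
  obtain ⟨φ, hφ⟩ := hb.exists_emul x
  refine ⟨⟨φ, energyInvariant_Hred hφ x.2⟩, maps_fnHf.2 fun n => ?_⟩
  filter_upwards [hφ n, x.2.2 n] with K h1 h2
  rcases lt_or_ge (energy K) 1 with hK | hK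
  · rw [h1, min_eq_left hK.le]
  · rw [h1, h2 hK, mul_zero, mul_zero]

/-- The inclusion of `𝓗_red` into the Fock space. -/
def inclFock (x : Hred) : Fock := ⟨x, x.2.1⟩

/-- The function `x⁻¹`, cut off below `3r/4`, where `χ̄_r` vanishes. -/
noncomputable def invCut (r x : ℝ) : ℝ := if 3 / 4 * r ≤ x then x⁻¹ else 0

lemma energyBounded_invCut {r : ℝ} (hr : 0 < r) : EnergyBounded (invCut r) := by
  refine ⟨fun n => ?_, (3 / 4 * r)⁻¹, fun x hx => ?_⟩
  · unfold invCut
    have hm := (continuous_energy n).measurable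
    exact Measurable.ite (measurableSet_le measurable_const hm) hm.inv measurable_const
  · unfold invCut
    split_ifs with h
    · rw [abs_of_nonneg (inv_nonneg.2 hx)]
      exact inv_anti₀ (by positivity) h
    · rw [abs_zero]
      positivity

namespace Model

variable (M : Model)

lemma chi_eq_zero {r x : ℝ} (hr : 0 < r) (h : r ≤ x) : M.chi r x = 0 := by
  obtain ⟨b, hb, hΘ⟩ := M.Θ_support
  rw [chi, hΘ _ (hb.le.trans ((one_le_div hr).2 h)), mul_zero, Real.sin_zero]

lemma chi_eq_one {r x : ℝ} (hr : 0 < r) (hx : 0 ≤ x) (h : x ≤ 3 / 4 * r) : M.chi r x = 1 := by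
  rw [chi, M.Θ_one _ (div_nonneg hx hr.le) ((div_le_iff₀ hr).2 h), mul_one, Real.sin_pi_div_two]

lemma chib_eq_zero {r x : ℝ} (hr : 0 < r) (hx : 0 ≤ x) (h : x ≤ 3 / 4 * r) :
    M.chib r x = 0 := by
  rw [chib, M.chi_eq_one hr hx h]
  simp

lemma chi_sq_add_chib_sq (r x : ℝ) : M.chi r x ^ 2 + M.chib r x ^ 2 = 1 := by
  have h : 0 ≤ 1 - M.chi r x ^ 2 := by
    unfold chi
    nlinarith [Real.sin_sq_add_cos_sq (Real.pi / 2 * M.Θ (x / r)),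
      sq_nonneg (Real.cos (Real.pi / 2 * M.Θ (x / r)))]
  rw [chib, Real.sq_sqrt h]
  ring

lemma chi_dilate (r s x : ℝ) (hs : s ≠ 0) : M.chi (s * r) (s * x) = M.chi r x := by
  rw [chi, chi, mul_div_mul_left _ _ hs]

lemma chib_dilate (r s x : ℝ) (hs : s ≠ 0) : M.chib (s * r) (s * x) = M.chib r x := by
  rw [chib, chib, chi_dilate _ _ _ _ hs]

lemma measurable_chi {r : ℝ} (hr : 0 < r) (n : ℕ) :
    Measurable fun K : Conf n => M.chi r (energy K) := by
  have h : Continuous fun K : Conf n => M.Θ (energy K / r) :=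
    M.Θ_smooth.continuousOn.comp_continuous ((continuous_energy n).div_const r)
      fun K => div_nonneg (energy_nonneg K) hr.le
  exact (Real.continuous_sin.comp (continuous_const.mul h)).measurable

lemma energyBounded_chi {r : ℝ} (hr : 0 < r) : EnergyBounded (M.chi r) :=
  ⟨M.measurable_chi hr, 1, fun _ _ => Real.abs_sin_le_one _⟩

lemma energyBounded_chib {r : ℝ} (hr : 0 < r) : EnergyBounded (M.chib r) := by
  refine ⟨fun n => ((measurable_const.sub ((M.measurable_chi hr n).pow_const 2)).sqrt), 1,
    fun x _ => ?_⟩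
  refine abs_le_of_sq_le_sq ?_ zero_le_one
  nlinarith [M.chi_sq_add_chib_sq r x, sq_nonneg (M.chi r x)]

/-- The function `χ̄_r(x) x⁻¹ χ̄_r(x)`. -/
noncomputable def chibInv (r x : ℝ) : ℝ := M.chib r x * (M.chib r x * invCut r x)

lemma energyBounded_chibInv {r : ℝ} (hr : 0 < r) : EnergyBounded (M.chibInv r) :=
  (M.energyBounded_chib hr).mul ((M.energyBounded_chib hr).mul (energyBounded_invCut hr))

lemma mul_chib_invCut {r x : ℝ} (hr : 0 < r) (hx : 0 ≤ x) :
    x * (M.chib r x * invCut r x) = M.chib r x := by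
  unfold invCut
  split_ifs with h
  · have : x ≠ 0 := (lt_of_lt_of_le (by positivity) h).ne'
    field_simp
  · rw [M.chib_eq_zero hr hx (not_le.1 h).le]
    ring

lemma chibInv_dilate (r s x : ℝ) (hs : 0 < s) :
    M.chibInv (s * r) (s * x) = s⁻¹ * M.chibInv r x := by
  have h : 3 / 4 * (s * r) ≤ s * x ↔ 3 / 4 * r ≤ x := by
    rw [mul_left_comm]
    exact mul_le_mul_iff_right₀ hs
  unfold chibInv invCut
  rw [chib_dilate _ _ _ _ hs.ne', if_congr h rfl rfl]
  split_ifs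
  · rw [mul_inv]; ring
  · ring

/-! ### The Feshbach map with energy cutoffs -/

variable {V : Submodule ℂ FullFock} {r : ℝ}

/-- `F_{χ_r[H_f]}(T, H_f)`. -/
noncomputable abbrev feshF (r : ℝ) (T : V →ₗ.[ℂ] V) : V →ₗ.[ℂ] V :=
  feshbach T (Hf V) (fnHf V V (M.chi r)) (fnHf V V (M.chib r))

/-- `Q_{χ_r[H_f]}(T, H_f)`. -/
noncomputable abbrev feshQr (r : ℝ) (T : V →ₗ.[ℂ] V) : V →ₗ.[ℂ] V :=
  feshQ T (Hf V) (fnHf V V (M.chi r)) (fnHf V V (M.chib r))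

/-- `Q_{χ_r[H_f]}^♯(T, H_f)`. -/
noncomputable abbrev feshQsr (r : ℝ) (T : V →ₗ.[ℂ] V) : V →ₗ.[ℂ] V :=
  feshQs T (Hf V) (fnHf V V (M.chi r)) (fnHf V V (M.chib r))

/-- `χ_r[H_f]` and `χ̄_r[H_f]` as everywhere defined linear maps. -/
lemma exists_cutoffs (hV : EnergyInvariant V) (hr : 0 < r) : ∃ X Xb : V →ₗ[ℂ] V,
    fnHf V V (M.chi r) = X.toPMap ⊤ ∧ fnHf V V (M.chib r) = Xb.toPMap ⊤ ∧
    (∀ x : V, EMul (M.chi r) x (X x)) ∧ (∀ x : V, EMul (M.chib r) x (Xb x)) ∧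
    (∀ x, X (Xb x) = Xb (X x)) ∧ ∀ x, X (X x) + Xb (Xb x) = x := by
  obtain ⟨X, hX, h1⟩ := (M.energyBounded_chi hr).exists_linearMap hV
  obtain ⟨Xb, hXb, h2⟩ := (M.energyBounded_chib hr).exists_linearMap hV
  refine ⟨X, Xb, hX, hXb, h1, h2, fun x => Subtype.ext ?_, fun x => Subtype.ext ?_⟩
  · exact (((h2 x).comp (h1 _)).congr fun y _ => mul_comm _ _).unique ((h1 x).comp (h2 _))
  · refine FullFock.ext_ae fun n => ?_
    filter_upwards [coe_add_ae (X (X x)) (Xb (Xb x)) n, (h1 x).comp (h1 _) n,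
      (h2 x).comp (h2 _) n] with K a b c
    rw [Submodule.coe_add, a, b, c, ← add_mul, ← Complex.ofReal_add, ← sq, ← sq,
      chi_sq_add_chib_sq, Complex.ofReal_one, one_mul]

variable {M} {T : V →ₗ.[ℂ] V} (hV : EnergyInvariant V) (hr : 0 < r)

include hV hr

lemma feshF_suppBelow {x z : V} (h : Maps (M.feshF r T) x z) {s : ℝ} (hs : r ≤ s)
    (hx : SuppBelow s (x : FullFock)) : SuppBelow s (z : FullFock) := by
  obtain ⟨X, Xb, hX, hXb, h1, h2, -, -⟩ := M.exists_cutoffs hV hr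
  rw [feshF, hX, hXb] at h
  obtain ⟨t, a, ht, rfl⟩ := feshbach_eq_tau_add h
  exact ((maps_fnHf.1 ht).suppBelow hx).add
    (((h1 a).suppBelow_of_support fun x => M.chi_eq_zero hr).mono hs)

variable (P : FeshbachPair T (Hf V) (fnHf V V (M.chi r)) (fnHf V V (M.chib r)))

include P

/-- `H Q_χ = χ F_χ`. -/
lemma maps_feshQr {x t : V} (hx : Maps (Hf V) x t) : ∃ q z u : V,
    Maps (M.feshQr r T) x q ∧ Maps (M.feshF r T) x z ∧
      EMul (M.chi r) z u ∧ Maps T q u := by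
  obtain ⟨X, Xb, hX, hXb, h1, -, -, hsq⟩ := M.exists_cutoffs hV hr
  rw [feshQr, feshF, hX, hXb]
  rw [hX, hXb] at P
  obtain ⟨q, z, h3, h4, h5⟩ := P.H_feshQ hsq hx
  exact ⟨q, z, X z, h3, h4, h1 z, h5⟩

/-- `Q_χ^♯ H = F_χ χ`. -/
lemma maps_feshQsr {x h u : V} (hx : Maps T x h) (hu : EMul (M.chi r) x u) : ∃ z : V,
    Maps (M.feshQsr r T) h z ∧ Maps (M.feshF r T) u z := by
  obtain ⟨X, Xb, hX, hXb, h1, -, -, hsq⟩ := M.exists_cutoffs hV hr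
  rw [feshQsr, feshF, hX, hXb]
  rw [hX, hXb] at P
  obtain rfl : u = X x := Subtype.ext (hu.unique (h1 x))
  exact P.feshQs_H hsq hx

/-- `Q_χ^♯ χ = 1 - F_χ χ̄ H_f⁻¹ χ̄`. -/
lemma maps_feshQsr_chi {z u : V} (hu : EMul (M.chi r) z u) : ∃ m c : V,
    EMul (M.chibInv r) z m ∧ Maps (M.feshF r T) m c ∧ Maps (M.feshQsr r T) u (z - c) := by
  obtain ⟨X, Xb, hX, hXb, h1, h2, hcomm, hsq⟩ := M.exists_cutoffs hV hr
  rw [feshQsr, feshF, hX, hXb]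
  rw [hX, hXb] at P
  obtain rfl : u = X z := Subtype.ext (hu.unique (h1 z))
  obtain ⟨v, hv⟩ := (energyBounded_invCut hr).exists_emul z
  have hw := hv.comp (h2 ⟨v, hV hv z.2⟩)
  have hτ : Maps (Hf V) (Xb ⟨v, hV hv z.2⟩) (Xb z) := maps_fnHf.2 fun n => by
    filter_upwards [hw n, h2 z n] with K a b
    rw [a, b, ← mul_assoc, ← Complex.ofReal_mul, M.mul_chib_invCut hr (energy_nonneg K)]
  obtain ⟨c, hc1, hc2⟩ := P.feshQs_chi hcomm hsq hτ
  exact ⟨_, c, hw.comp (h2 _), hc2, hc1⟩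

end Model

/-! ### The iteration -/

/-- `H_f` is injective on `Ran χ̄_1[H_f]` in `𝓗_red`, because it is so in the Fock space. -/
lemma Hf_injOn_ran {f : ℝ → ℝ}
    (hinv : BoundedInvertibleOn (Hf Fock) (ran (fnHf Fock Fock f))) {w : Hred}
    (hw : w ∈ ran (fnHf Hred Hred f)) (h0 : Maps (Hf Hred) w 0) : w = 0 := by
  have hcont : Continuous inclFock := Continuous.subtype_mk continuous_subtype_val _
  have hmem : inclFock w ∈ ran (fnHf Fock Fock f) := by
    refine map_mem_closure hcont (s := (LinearMap.range (fnHf Hred Hred f).toFun : Set Hred)) hw ?_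
    rintro _ ⟨v, rfl⟩
    have hv : Maps (fnHf Fock Fock f) (inclFock v) (inclFock (fnHf Hred Hred f v)) :=
      maps_fnHf.2 (maps_fnHf.1 (maps_apply (fnHf Hred Hred f) v) :
        EMul f (v : Hred) (fnHf Hred Hred f v))
    obtain ⟨hd, he⟩ := maps_iff.1 hv
    exact ⟨⟨_, hd⟩, he⟩
  have h0' : Maps (Hf Fock) (inclFock w) 0 := maps_fnHf.2
    (maps_fnHf.1 h0 : EMul (fun x => x) w (0 : Hred))
  exact Subtype.ext (congrArg (Subtype.val : Fock → FullFock) (hinv.eq_zero hmem h0'))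

namespace Model

variable {M : Model}

lemma chi_one_mul_chi_rho (x : ℝ) (hx : 0 ≤ x) : M.chi 1 x * M.chi M.ρ x = M.chi M.ρ x := by
  have h := M.ρ_le
  rcases le_total M.ρ x with hρ | hρ
  · rw [M.chi_eq_zero M.ρ_pos hρ, mul_zero]
  · rw [M.chi_eq_one one_pos hx (by linarith), one_mul]

lemma chi_dil (x : ℝ) : M.chi 1 (M.ρ⁻¹ * x) = M.chi M.ρ x := by
  rw [← M.chi_dilate M.ρ M.ρ⁻¹ x (inv_ne_zero M.ρ_pos.ne'), inv_mul_cancel₀ M.ρ_pos.ne']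

lemma chi_dil' (x : ℝ) : M.chi M.ρ (M.ρ * x) = M.chi 1 x := by
  rw [← M.chi_dilate 1 M.ρ x M.ρ_pos.ne', mul_one]

/-- `Γ_ρ^*` maps `𝓗_red` into `1[H_f < ρ] 𝓗_red`. -/
lemma exists_dil_inv_Hred (M : Model) (x : Hred) :
    ∃ y : Hred, Dil M.ρ⁻¹ x y ∧ SuppBelow M.ρ (y : FullFock) := by
  have hr := inv_pos.2 M.ρ_pos
  obtain ⟨φ, hφ⟩ := exists_dil hr x
  have hs : SuppBelow M.ρ φ :=
    hφ.suppBelow hr (by rw [inv_mul_cancel₀ M.ρ_pos.ne']; exact x.2.2)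
  exact ⟨⟨φ, hφ.mem_Fock hr x.2.1, hs.mono (M.ρ_le.trans (by norm_num))⟩, hφ, hs⟩

/-- `Γ_ρ` maps `1[H_f < ρ] 𝓗_red` into `𝓗_red`. -/
lemma exists_dil_Hred (M : Model) {x : Hred} (hx : SuppBelow M.ρ (x : FullFock)) :
    ∃ y : Hred, Dil M.ρ x y := by
  obtain ⟨φ, hφ⟩ := exists_dil M.ρ_pos x
  exact ⟨⟨φ, hφ.mem_Fock M.ρ_pos x.2.1, hφ.suppBelow M.ρ_pos (by rwa [mul_one])⟩, hφ⟩

lemma exists_dil_Fock {r : ℝ} (hr : 0 < r) (x : Fock) : ∃ y : Fock, Dil r x y := by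
  obtain ⟨φ, hφ⟩ := exists_dil hr x
  exact ⟨⟨φ, hφ.mem_Fock hr x.2⟩, hφ⟩

lemma maps_H_zero {x y : Hred}
    (h : Maps (M.feshF 1 M.Hm1) (inclFock x) (inclFock y)) : Maps (M.H 0) x y :=
  maps_comp.2 ⟨_, maps_comp.2 ⟨_, maps_ident.2 rfl, h⟩, maps_ident.2 rfl⟩

/-- `H_(n+1) Γ_ρ = ρ⁻¹ Γ_ρ F_{χ_ρ}(H_(n), H_f)` on vectors of energy below `ρ`. -/
lemma exists_maps_H_succ {n : ℕ} {x z : Hred} (hx : SuppBelow M.ρ (x : FullFock))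
    (h : Maps (M.feshF M.ρ (M.H n)) x z) : ∃ x' z' : Hred, Dil M.ρ x x' ∧ Dil M.ρ z z' ∧
      Maps (M.H (n + 1)) x' (((M.ρ⁻¹ : ℝ) : ℂ) • z') := by
  obtain ⟨x', hx'⟩ := M.exists_dil_Hred hx
  obtain ⟨z', hz'⟩ := M.exists_dil_Hred
    (feshF_suppBelow energyInvariant_Hred M.ρ_pos h le_rfl hx)
  exact ⟨x', z', hx', hz', maps_smul.2 ⟨z', maps_comp.2 ⟨z, maps_comp.2
    ⟨x, maps_dil.2 (hx'.symm M.ρ_pos), h⟩, maps_dil.2 hz'⟩, rfl⟩⟩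

lemma maps_Qm1n_zero {x : Hred} {q : Fock} (h : Maps (M.feshQr 1 M.Hm1) (inclFock x) q) :
    Maps (M.Qm1n 0) x q :=
  maps_comp.2 ⟨x, maps_pid.2 rfl, maps_comp.2 ⟨_, maps_ident.2 rfl, h⟩⟩

lemma maps_Qm1n_succ {n : ℕ} {x x' y : Hred} {q : Fock} (h1 : Dil M.ρ⁻¹ x x')
    (h2 : Maps (M.Q n) x' y) (h3 : Maps (M.Qm1n n) y q) : Maps (M.Qm1n (n + 1)) x q := by
  obtain ⟨w, hw, hq⟩ := maps_comp.1 h3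
  exact maps_comp.2 ⟨w, maps_comp.2 ⟨y, maps_comp.2 ⟨x', maps_dil.2 h1, h2⟩, hw⟩, hq⟩

lemma maps_Qm1ns_zero {x : Fock} {y : Hred} (h : Maps (M.feshQsr 1 M.Hm1) x (inclFock y)) :
    Maps (M.Qm1ns 0) x y :=
  maps_comp.2 ⟨y, maps_comp.2 ⟨_, h, maps_ident.2 rfl⟩, maps_pid.2 rfl⟩

lemma maps_Qm1ns_succ {n : ℕ} {x : Fock} {y y' z : Hred} (h1 : Maps (M.Qm1ns n) x y)
    (h2 : Maps (M.Qs n) y y') (h3 : Dil M.ρ y' z) : Maps (M.Qm1ns (n + 1)) x z := by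
  obtain ⟨w, hw, hq⟩ := maps_comp.1 h1
  exact maps_comp.2 ⟨w, hw, maps_comp.2 ⟨y', maps_comp.2 ⟨y, hq, h2⟩, maps_dil.2 h3⟩⟩

lemma exists_maps_Hf_inclFock (x : Hred) : ∃ t, Maps (Hf Fock) (inclFock x) t := by
  obtain ⟨t, ht⟩ := exists_maps_Hf_Hred x
  exact ⟨inclFock t, maps_fnHf.2 (maps_fnHf.1 ht : EMul (fun x => x) x t)⟩

/-- `F_{χ_1}(H_(-1), H_f)` leaves `𝓗_red` invariant. -/
lemma exists_inclFock_eq_of_feshF {x : Hred} {z : Fock}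
    (h : Maps (M.feshF 1 M.Hm1) (inclFock x) z) : ∃ y, inclFock y = z :=
  ⟨⟨z, z.2, feshF_suppBelow energyInvariant_Fock one_pos h le_rfl x.2.2⟩, rfl⟩

/-- The effective Hamiltonians are everywhere defined. -/
lemma exists_maps_H (h_init : M.InitialFeshbachPair) :
    ∀ n, (∀ k < n, M.RedFeshbachPair (M.H k)) → ∀ x, ∃ y, Maps (M.H n) x y
  | 0, _, x => by
    obtain ⟨t, ht⟩ := exists_maps_Hf_inclFock x
    obtain ⟨q, z, u, -, hz, -, -⟩ := maps_feshQr energyInvariant_Fock one_pos h_init ht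
    obtain ⟨y, rfl⟩ := exists_inclFock_eq_of_feshF hz
    exact ⟨y, maps_H_zero hz⟩
  | n + 1, h_red, x => by
    obtain ⟨x', hx', hs⟩ := M.exists_dil_inv_Hred x
    obtain ⟨t, ht⟩ := exists_maps_Hf_Hred x'
    obtain ⟨q, z, u, -, hz, -, -⟩ :=
      maps_feshQr energyInvariant_Hred M.ρ_pos (h_red n n.lt_succ_self) ht
    obtain ⟨x'', z', h1, -, h2⟩ := exists_maps_H_succ hs hz
    obtain rfl : x'' = x := Subtype.ext (h1.unique (by simpa using hx'.symm (inv_pos.2 M.ρ_pos)))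
    exact ⟨_, h2⟩

/-- One step of the renormalization group: `H_(n) Q_(n) Γ_ρ^* = ρ χ_ρ[H_f] Γ_ρ^* H_(n+1)`. The
vector `z` is `F_{χ_ρ}(H_(n), H_f) Γ_ρ^* x`, and `z'` is `ρ H_(n+1) x`. -/
lemma exists_maps_Q_step {n : ℕ} (P : M.RedFeshbachPair (M.H n)) (x : Hred) :
    ∃ x' q z u z' : Hred, Dil M.ρ⁻¹ x x' ∧ Maps (M.Q n) x' q ∧ EMul (M.chi M.ρ) z u ∧
      Maps (M.H n) q u ∧ Dil M.ρ z z' ∧ SuppBelow M.ρ (z : FullFock) ∧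
      Maps (M.H (n + 1)) x (((M.ρ⁻¹ : ℝ) : ℂ) • z') := by
  obtain ⟨x', hx', hs⟩ := M.exists_dil_inv_Hred x
  obtain ⟨t, ht⟩ := exists_maps_Hf_Hred x'
  obtain ⟨q, z, u, hq, hz, hu, hqu⟩ := maps_feshQr energyInvariant_Hred M.ρ_pos P ht
  obtain ⟨x'', z', h1, hz', h2⟩ := exists_maps_H_succ hs hz
  obtain rfl : x'' = x := Subtype.ext (h1.unique (by simpa using hx'.symm (inv_pos.2 M.ρ_pos)))
  exact ⟨x', q, z, u, z', hx', hq, hu, hqu, hz',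
    feshF_suppBelow energyInvariant_Hred M.ρ_pos hz le_rfl hs, h2⟩

/-- `H_(-1) Q_(-1,n) = ρⁿ (Γ_ρ^*)ⁿ χ_1[H_f] H_(n)`. -/
theorem exists_maps_Hm1_Qm1n (h_init : M.InitialFeshbachPair) :
    ∀ n, (∀ k < n, M.RedFeshbachPair (M.H k)) → ∀ x y, Maps (M.H n) x y →
      ∃ q u v : Fock, Maps (M.Qm1n n) x q ∧ EMul (M.chi 1) y u ∧
        Maps (ppow (M.Γstar Fock Fock) n) u v ∧ Maps M.Hm1 q (((M.ρ ^ n : ℝ) : ℂ) • v)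
  | 0, _, x, y, hxy => by
    obtain ⟨t, ht⟩ := exists_maps_Hf_inclFock x
    obtain ⟨q, z, u, hq, hz, hu, hqu⟩ := maps_feshQr energyInvariant_Fock one_pos h_init ht
    obtain ⟨y', rfl⟩ := exists_inclFock_eq_of_feshF hz
    obtain rfl := hxy.unique (maps_H_zero hz)
    exact ⟨q, u, u, maps_Qm1n_zero hq, hu, maps_pid.2 rfl, by simpa using hqu⟩
  | n + 1, h_red, x, y, hxy => by
    obtain ⟨x', q', z, u', z', hx', hq', hu', hqu', hz', -, hH⟩ :=
      exists_maps_Q_step (h_red n n.lt_succ_self) x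
    obtain rfl := hxy.unique hH
    obtain ⟨q, u, v, hq, hu, hv, hqv⟩ :=
      exists_maps_Hm1_Qm1n h_init n (fun k hk => h_red k (hk.trans n.lt_succ_self)) q' u' hqu'
    -- `χ_1 χ_ρ = χ_ρ`
    have hu1 : EMul (M.chi M.ρ) z u := (hu'.comp hu).congr chi_one_mul_chi_rho
    obtain ⟨w, hw⟩ := (M.energyBounded_chi one_pos).exists_emul z'
    have hwF : w ∈ Fock := hw.mem_Fock z'.2.1
    have hd : Dil M.ρ⁻¹ w u := hz'.symm M.ρ_pos |>.emul (inv_pos.2 M.ρ_pos) hw hu1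
      fun x _ => chi_dil x
    refine ⟨q, ((M.ρ⁻¹ : ℝ) : ℂ) • ⟨w, hwF⟩, ((M.ρ⁻¹ : ℝ) : ℂ) • v,
      maps_Qm1n_succ hx' hq' hq, hw.smul _, maps_ppow_succ.2 ⟨((M.ρ⁻¹ : ℝ) : ℂ) • u,
        maps_dil.2 (hd.smul (inv_pos.2 M.ρ_pos) _), hv.smul _⟩, hqv.congr rfl ?_⟩
    rw [smul_smul, ← Complex.ofReal_mul, pow_succ, mul_assoc, mul_inv_cancel₀ M.ρ_pos.ne', mul_one]

/-- `Q_(-1,n)^♯ H_(-1) = ρⁿ H_(n) χ_1[H_f] Γ_ρⁿ` on the domain of `H_(-1)`. -/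
theorem exists_maps_Qm1ns_Hm1 (h_init : M.InitialFeshbachPair) :
    ∀ n, (∀ k < n, M.RedFeshbachPair (M.H k)) → ∀ x h, Maps M.Hm1 x h →
      ∃ (a : Fock) (b c : Hred), Maps (ppow (M.Γ Fock Fock) n) x a ∧ EMul (M.chi 1) a b ∧
        Maps (M.H n) b c ∧ Maps (M.Qm1ns n) h (((M.ρ ^ n : ℝ) : ℂ) • c)
  | 0, _, x, h, hxh => by
    obtain ⟨φ, hφ⟩ := (M.energyBounded_chi one_pos).exists_emul x
    let b : Hred := ⟨φ, hφ.mem_Fock x.2,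
      hφ.suppBelow_of_support fun x => M.chi_eq_zero one_pos⟩
    obtain ⟨z, hz1, hz2⟩ :=
      maps_feshQsr energyInvariant_Fock one_pos h_init hxh (u := inclFock b) hφ
    obtain ⟨c, rfl⟩ := exists_inclFock_eq_of_feshF hz2
    exact ⟨x, b, c, maps_pid.2 rfl, hφ, maps_H_zero hz2,
      by simpa using maps_Qm1ns_zero hz1⟩
  | n + 1, h_red, x, h, hxh => by
    obtain ⟨a, b, c, ha, hb, hbc, hc⟩ :=
      exists_maps_Qm1ns_Hm1 h_init n (fun k hk => h_red k (hk.trans n.lt_succ_self)) x h hxh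
    obtain ⟨φ, hφ⟩ := (M.energyBounded_chi M.ρ_pos).exists_emul b
    let u : Hred := ⟨φ, energyInvariant_Hred hφ b.2⟩
    obtain ⟨s, hs1, hs2⟩ := maps_feshQsr energyInvariant_Hred M.ρ_pos
      (h_red n n.lt_succ_self) hbc (u := u) hφ
    obtain ⟨u', s', hu', hs', hH⟩ := exists_maps_H_succ
      (hφ.suppBelow_of_support fun x => M.chi_eq_zero M.ρ_pos) hs2
    obtain ⟨a', ha'⟩ := exists_dil_Fock M.ρ_pos a
    have hau : EMul (M.chi M.ρ) a u := (hb.comp hφ).congr fun x hx => by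
      rw [mul_comm, chi_one_mul_chi_rho x hx]
    -- `Γ_ρ χ_ρ = χ_1 Γ_ρ`
    have hau' : EMul (M.chi 1) a' u' := by
      obtain ⟨w, hw⟩ := (M.energyBounded_chi one_pos).exists_emul a'
      have := ha'.emul M.ρ_pos hau hw fun x _ => chi_dil' x
      rwa [this.unique hu'] at hw
    refine ⟨a', u', _, maps_comp.2 ⟨a, ha, maps_dil.2 ha'⟩, hau', hH,
      (maps_Qm1ns_succ (z := ((M.ρ ^ n : ℝ) : ℂ) • s') hc (hs1.smul _)
        (hs'.smul M.ρ_pos _)).congr rfl ?_⟩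
    rw [smul_smul, ← Complex.ofReal_mul, pow_succ, mul_assoc, mul_inv_cancel₀ M.ρ_pos.ne', mul_one]

lemma chibInv_eq_zero_of_lt_rho {x : ℝ} (hx : 0 ≤ x) (h : x < M.ρ) : M.chibInv 1 x = 0 := by
  have := M.ρ_le
  rw [chibInv, M.chib_eq_zero one_pos hx (by linarith), zero_mul]

/-- The collapsing identity
`Q_(-1,n)^♯ H_(-1) Q_(-1,n) = ρⁿ (H_(n) - H_(n) χ̄_1 H_f⁻¹ χ̄_1 H_(n))`. -/
theorem exists_maps_collapse (h_init : M.InitialFeshbachPair) :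
    ∀ n, (∀ k < n, M.RedFeshbachPair (M.H k)) → ∀ x y, Maps (M.H n) x y →
      ∃ (q h : Fock) (m c : Hred), Maps (M.Qm1n n) x q ∧ Maps M.Hm1 q h ∧
        EMul (M.chibInv 1) y m ∧ Maps (M.H n) m c ∧
        Maps (M.Qm1ns n) h (((M.ρ ^ n : ℝ) : ℂ) • (y - c))
  | 0, _, x, y, hxy => by
    obtain ⟨t, ht⟩ := exists_maps_Hf_inclFock x
    obtain ⟨q, z, u, hq, hz, hu, hqu⟩ := maps_feshQr energyInvariant_Fock one_pos h_init ht
    obtain ⟨y', rfl⟩ := exists_inclFock_eq_of_feshF hz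
    obtain rfl := hxy.unique (maps_H_zero hz)
    obtain ⟨m, c, hm, hc, hs⟩ := maps_feshQsr_chi energyInvariant_Fock one_pos h_init hu
    obtain ⟨m, rfl⟩ : ∃ m', inclFock m' = m := ⟨⟨m, energyInvariant_Hred hm y.2⟩, rfl⟩
    obtain ⟨c, rfl⟩ := exists_inclFock_eq_of_feshF hc
    refine ⟨q, u, m, c, maps_Qm1n_zero hq, hqu, hm, maps_H_zero hc, ?_⟩
    rw [pow_zero, Complex.ofReal_one, one_smul]
    exact maps_Qm1ns_zero hs
  | n + 1, h_red, x, y, hxy => by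
    have P := h_red n n.lt_succ_self
    have hρ := M.ρ_pos
    obtain ⟨x', q', z, u', z', hx', hq', hu', hqu', hz', hzs, hH⟩ := exists_maps_Q_step P x
    obtain rfl := hxy.unique hH
    obtain ⟨q, h, m, c, hq, hqh, hm, hc, hs⟩ :=
      exists_maps_collapse h_init n (fun k hk => h_red k (hk.trans n.lt_succ_self)) q' u' hqu'
    -- `χ̄_1 χ_ρ = 0`, so the correction term of the previous scale drops out
    obtain rfl : m = 0 := Subtype.ext (hm.eq_zero (hu'.suppBelow hzs)
      fun x => chibInv_eq_zero_of_lt_rho)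
    obtain rfl := hc.unique (Maps.zero _)
    rw [sub_zero] at hs
    obtain ⟨m, c, hm, hc, hzc⟩ := maps_feshQsr_chi energyInvariant_Hred hρ P hu'
    obtain ⟨m', c', hm', hc', hH'⟩ := exists_maps_H_succ (hm.suppBelow hzs) hc
    -- `Γ_ρ χ̄_ρ H_f⁻¹ χ̄_ρ = ρ⁻¹ χ̄_1 H_f⁻¹ χ̄_1 Γ_ρ`
    have hmz : EMul (M.chibInv 1) (((M.ρ⁻¹ : ℝ) : ℂ) • z') m' := by
      obtain ⟨w, hw⟩ := (M.energyBounded_chibInv one_pos).exists_emul z'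
      have hd := hz'.emul hρ hm (hw.const_mul M.ρ⁻¹) fun x _ => by
        rw [← M.chibInv_dilate 1 M.ρ x hρ, mul_one]
      have hw' := hw.smul ((M.ρ⁻¹ : ℝ) : ℂ)
      rwa [← hm'.unique hd] at hw'
    have hzc' : Dil M.ρ (z - c : Hred) (z' - c' : Hred) :=
      maps_dil.1 ((maps_dil (hr := hρ).2 hz').sub (maps_dil.2 hc'))
    refine ⟨q, h, m', _, maps_Qm1n_succ hx' hq' hq, hqh, hmz, hH',
      (maps_Qm1ns_succ (z := ((M.ρ ^ n : ℝ) : ℂ) • (z' - c')) hs (hzc.smul _)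
        (hzc'.smul hρ _)).congr rfl ?_⟩
    rw [← smul_sub, smul_smul, ← Complex.ofReal_mul, pow_succ, mul_assoc,
      mul_inv_cancel₀ hρ.ne', mul_one]

lemma exists_maps_ppow_Γ (M : Model) (n : ℕ) (x : Fock) :
    ∃ y, Maps (ppow (M.Γ Fock Fock) n) x y := by
  induction n with
  | zero => exact ⟨x, maps_pid.2 rfl⟩
  | succ n ih =>
    obtain ⟨y, hy⟩ := ih
    obtain ⟨z, hz⟩ := exists_dil_Fock M.ρ_pos y
    exact ⟨z, maps_comp.2 ⟨y, hy, maps_dil.2 hz⟩⟩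

/-- `H_f⁻¹ χ̄_1[H_f]` on `𝓗_red`. -/
lemma maps_invOn_Hf (h_init : M.InitialFeshbachPair) {y m : Hred} (hm : EMul (M.chibInv 1) y m) :
    ∃ y' w : Hred, EMul (M.chib 1) y y' ∧
      Maps (invOn (Hf Hred) (ran (fnHf Hred Hred (M.chib 1)))) y' w ∧ EMul (M.chib 1) w m := by
  have hb := M.energyBounded_chib one_pos
  obtain ⟨y', hy'⟩ := hb.exists_emul y
  obtain ⟨v, hv⟩ := (energyBounded_invCut one_pos).exists_emul y
  obtain ⟨w, hw⟩ := hb.exists_emul v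
  have hvV := energyInvariant_Hred hv y.2
  have hwV := energyInvariant_Hred hw hvV
  refine ⟨⟨y', energyInvariant_Hred hy' y.2⟩, ⟨w, hwV⟩, hy', ?_, ?_⟩
  · rw [maps_invOn fun x hx h0 => Hf_injOn_ran h_init.inv_τ hx h0]
    constructor
    · obtain ⟨hd, he⟩ := maps_iff.1
        (maps_fnHf.2 hw : Maps (fnHf Hred Hred (M.chib 1)) ⟨v, hvV⟩ ⟨w, hwV⟩)
      exact Submodule.le_topologicalClosure _ ⟨⟨_, hd⟩, he⟩
    · refine maps_fnHf.2 fun n => ?_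
      filter_upwards [hv.comp hw n, hy' n] with K a b
      rw [a, b, ← mul_assoc, ← Complex.ofReal_mul, M.mul_chib_invCut one_pos (energy_nonneg K)]
  · obtain ⟨m', hm'⟩ := hb.exists_emul w
    rwa [hm.unique ((hv.comp hw).comp hm')]

end Model

end QED

theorem lemma14p2 (M : QED.Model) (n : ℕ)
    (h_init : M.InitialFeshbachPair)
    (h_red : ∀ k < n, M.RedFeshbachPair (M.H k)) :
    -- `H_(-1) Q_(-1,n) = ρⁿ (Γ_ρ^*)ⁿ χ_1[H_f] H_(n)`, as everywhere defined operators `𝓗_red → 𝓕`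
    ((M.Hm1 ∘ₚ M.Qm1n n).domain = ⊤ ∧
      M.Hm1 ∘ₚ M.Qm1n n =
        ((M.ρ ^ n : ℝ) : ℂ) •
          (ppow (M.Γstar Fock Fock) n ∘ₚ fnHf Hred Fock (M.chi 1) ∘ₚ M.H n)) ∧
    -- `Q_(-1,n)^♯ H_(-1) = ρⁿ H_(n) χ_1[H_f] Γ_ρⁿ` on the domain of `H_(-1)`; the right-hand
    -- side is an everywhere defined operator `𝓕 → 𝓗_red`
    ((M.Qm1ns n ∘ₚ M.Hm1).domain = M.Hm1.domain ∧
      (M.H n ∘ₚ fnHf Fock Hred (M.chi 1) ∘ₚ ppow (M.Γ Fock Fock) n).domain = ⊤ ∧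
      M.Qm1ns n ∘ₚ M.Hm1 ≤
        ((M.ρ ^ n : ℝ) : ℂ) •
          (M.H n ∘ₚ fnHf Fock Hred (M.chi 1) ∘ₚ ppow (M.Γ Fock Fock) n)) ∧
    -- the collapsing identity, as everywhere defined operators on `𝓗_red`
    ((M.Qm1ns n ∘ₚ M.Hm1 ∘ₚ M.Qm1n n).domain = ⊤ ∧
      M.Qm1ns n ∘ₚ M.Hm1 ∘ₚ M.Qm1n n =
        ((M.ρ ^ n : ℝ) : ℂ) •
          (M.H n - M.H n ∘ₚ fnHf Hred Hred (M.chib 1) ∘ₚ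
            invOn (Hf Hred) (ran (fnHf Hred Hred (M.chib 1))) ∘ₚ
            fnHf Hred Hred (M.chib 1) ∘ₚ M.H n)) := by
  refine ⟨?_, ⟨?_, ?_, ?_⟩, ?_⟩
  · refine eq_of_forall_exists_maps fun x => ?_
    obtain ⟨y, hy⟩ := Model.exists_maps_H h_init n h_red x
    obtain ⟨q, u, v, hq, hu, hv, h⟩ := Model.exists_maps_Hm1_Qm1n h_init n h_red x y hy
    exact ⟨_, maps_comp.2 ⟨q, hq, h⟩, maps_smul.2 ⟨v, maps_comp.2
      ⟨u, maps_comp.2 ⟨y, hy, maps_fnHf.2 hu⟩, hv⟩, rfl⟩⟩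
  · ext x
    constructor
    · intro hx
      obtain ⟨z, hz⟩ := mem_domain_iff_maps.1 hx
      obtain ⟨h, hh, -⟩ := maps_comp.1 hz
      exact hh.mem_domain
    · intro hx
      obtain ⟨h, hh⟩ := mem_domain_iff_maps.1 hx
      obtain ⟨a, b, c, -, -, -, hc⟩ := Model.exists_maps_Qm1ns_Hm1 h_init n h_red x h hh
      exact (maps_comp.2 ⟨h, hh, hc⟩).mem_domain
  · refine eq_top_iff.2 fun x _ => ?_
    obtain ⟨a, ha⟩ := M.exists_maps_ppow_Γ n x
    obtain ⟨φ, hφ⟩ := (M.energyBounded_chi one_pos).exists_emul a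
    obtain ⟨c, hc⟩ := Model.exists_maps_H h_init n h_red
      ⟨φ, hφ.mem_Fock a.2, hφ.suppBelow_of_support fun x => M.chi_eq_zero one_pos⟩
    exact (maps_comp.2 ⟨_, maps_comp.2 ⟨a, ha, maps_fnHf.2 hφ⟩, hc⟩).mem_domain
  · refine le_of_maps fun x z hz => ?_
    obtain ⟨h, hh, hz⟩ := maps_comp.1 hz
    obtain ⟨a, b, c, ha, hb, hbc, hc⟩ := Model.exists_maps_Qm1ns_Hm1 h_init n h_red x h hh
    exact maps_smul.2 ⟨c, maps_comp.2 ⟨b, maps_comp.2 ⟨a, ha, maps_fnHf.2 hb⟩, hbc⟩,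
      hz.unique hc⟩
  · refine eq_of_forall_exists_maps fun x => ?_
    obtain ⟨y, hy⟩ := Model.exists_maps_H h_init n h_red x
    obtain ⟨q, h, m, c, hq, hqh, hm, hc, hs⟩ := Model.exists_maps_collapse h_init n h_red x y hy
    obtain ⟨y', w, hy', hw, hm'⟩ := Model.maps_invOn_Hf h_init hm
    exact ⟨_, maps_comp.2 ⟨h, maps_comp.2 ⟨q, hq, hqh⟩, hs⟩, maps_smul.2 ⟨_, maps_sub.2
      ⟨y, c, hy, maps_comp.2 ⟨m, maps_comp.2 ⟨w, maps_comp.2 ⟨y', maps_comp.2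
        ⟨y, hy, maps_fnHf.2 hy'⟩, hw⟩, maps_fnHf.2 hm'⟩, hc⟩, rfl⟩, rfl⟩⟩
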